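/- \textbf{Setting.} A network is a finite directed multigraph $(V,E)$ with distinct source $s$ and sink $t$, a constant inflow rate $u_0>0$, capacities $\nu_e>0$ and transit times $\tau_e\ge 0$, such that every directed cycle has positive total transit time. For a labelling $\ell\in\mathbb{R}^V$ let \[E'_\ell=\{e=vw\in E:\ \ell_w\ge \ell_v+\tau_e\},\qquad E^*_\ell=\{e=vw\in E:\ \ell_w> \ell_v+\tau_e\}\] be the sets of active and of resetting arcs. Let $\Omega$ be the set of feasible labellings, that is, of those $\ell\in\mathbb{R}^V$ for which every node is reachable from $s$ by a directed path in $E'_\ell$, and for which $t$ is reachable in $E'_\ell$ from the head $w$ of every arc $vw\in E^*_\ell$. A thin flow at $\ell$ is a pair $(x,\lambda)$, where $x\ge 0$ is a static $s$-$t$-flow of value $u_0$ that vanishes outside $E'_\ell$ and $\lambda\in\mathbb{R}^V$ satisfies $\lambda_s=1$, \[\lambda_w=\min_{e=vw\in E'_\ell}\rho_e(\lambda_v,x_e)\ \text{ for } w\ne s,\qquad \lambda_w=\rho_e(\lambda_v,x_e)\ \text{ for } e=vw\in E'_\ell \text{ with } x_e>0,\] where $\rho_e(\lambda_v,x_e)=x_e/\nu_e$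 if $e\in E^*_\ell$ and $\rho_e(\lambda_v,x_e)=\max\{\lambda_v,x_e/\nu_e\}$ otherwise. For $\ell\in\Omega$ the vector $\lambda$ exists and is unique; denote it by $X(\ell)$. For $\ell^\circ\in\Omega$ let $\mathcal F_{\ell^\circ}$ be the set of Nash trajectories starting at $\ell^\circ$, i.e.\ of all locally absolutely continuous $\ell:[0,\infty)\to\Omega$ with $\ell(0)=\ell^\circ$ and $\ell'(\theta)=X(\ell(\theta))$ for almost every $\theta\ge 0$. Let $\|\cdot\|$ be the $1$-norm on $\mathbb{R}^V$ and $B_\delta(\ell^\circ)$ the closed ball of radius $\delta$ around $\ell^\circ$. \textbf{Lemma.} Let $\ell^\circ\in\Omega$. There exist $\hat\theta>0$ and a Nash trajectory $\ell^*\in\mathcal F_{\ell^\circ}$ with $\ell^*(\theta)=\ell^\circ+\theta\, X(\ell^\circ)$ for all $\theta\in[0,\hat\theta]$ such that the following holds: for every $\epsilon>0$ there is a $\delta>0$ such that for every $\tilde\ell^\circ\in B_\delta(\ell^\circ)\cap\Omega$ and every Nash trajectory $\tilde\ell\in\mathcal F_{\tilde\ell^\circ}$ we have \[\|\ell^*(\theta)-\tilde\ell(\theta)\|\le\epsilon\qquad\text{for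 all }\theta\in[0,\hat\theta].\] -/

import Mathlib

open MeasureTheory Set

noncomputable section

/-- A flow-over-time network: a finite directed multigraph with nodes `V` and arcs `E`,
a source and a sink, a constant inflow rate at the source, arc capacities and arc transit times.
The last field says that no directed cycle consists of arcs of transit time zero; since transit
times are nonnegative, this says that every directed cycle has positive total transit time. -/
structure FlowNetwork (V E : Type*) where
  /-- tail `v` of an arc `vw` -/
  src : E → V
  /-- head `w` of an arc `vw` -/
  tgt : E → V
  /-- source -/
  s : V
  /-- sink -/
  t : V
  s_ne_t : s ≠ t
  /-- network inflow rate -/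
  u₀ : ℝ
  u₀_pos : 0 < u₀
  /-- arc capacities -/
  ν : E → ℝ
  ν_pos : ∀ e, 0 < ν e
  /-- arc transit times -/
  τ : E → ℝ
  τ_nonneg : ∀ e, 0 ≤ τ e
  no_zero_cycle : ∀ v : V,
    ¬ Relation.TransGen (fun a b => ∃ e, src e = a ∧ tgt e = b ∧ τ e = 0) v v

namespace FlowNetwork

variable {V E : Type*} (N : FlowNetwork V E)

/-- The active arcs `E'` at the labelling `ℓ`: arcs `vw` with `ℓ_w ≥ ℓ_v + τ_e`. -/
def activeArcs (ℓ : V → ℝ) : Set E :=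
  {e | ℓ (N.src e) + N.τ e ≤ ℓ (N.tgt e)}

/-- The resetting arcs `E*` at the labelling `ℓ`: arcs `vw` with `ℓ_w > ℓ_v + τ_e`
(the arcs with a positive queue). -/
def resettingArcs (ℓ : V → ℝ) : Set E :=
  {e | ℓ (N.src e) + N.τ e < ℓ (N.tgt e)}

/-- `w` can be reached from `v` by a (possibly trivial) directed path using arcs of `A` only. -/
def ReachableIn (A : Set E) (v w : V) : Prop :=
  Relation.ReflTransGen (fun a b => ∃ e ∈ A, N.src e = a ∧ N.tgt e = b) v w

/-- The set `Ω` of feasible labellings: every node is reachable from the source by active arcs,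
and from the head of every resetting arc the sink is reachable by active arcs (so that every
resetting arc lies on an active source-sink path). -/
def feasibleLabellings : Set (V → ℝ) :=
  {ℓ | (∀ v, N.ReachableIn (N.activeArcs ℓ) N.s v) ∧
    ∀ e ∈ N.resettingArcs ℓ, N.ReachableIn (N.activeArcs ℓ) (N.tgt e) N.t}

open Classical in
/-- `x` is a static source-sink flow of value `u₀` supported on the arc set `A`. -/
structure IsStaticFlow [Fintype E] (A : Set E) (x : E → ℝ) : Prop where
  nonneg : ∀ e, 0 ≤ x e
  supported : ∀ e, e ∉ A → x e = 0
  conservation : ∀ v, (∑ e with N.src e = v, x e) - (∑ e with N.tgt e = v, x e) =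
    if v = N.s then N.u₀ else if v = N.t then -N.u₀ else 0

open Classical in
/-- The function `ρ_e(λ_v, x_e)` of the thin flow conditions, where `R` is the set of resetting
arcs: `x_e / ν_e` on resetting arcs and `max {λ_v, x_e / ν_e}` on the other arcs. -/
def rho (R : Set E) (e : E) (a y : ℝ) : ℝ :=
  if e ∈ R then y / N.ν e else max a (y / N.ν e)

/-- `(x, lam)` is a normalized thin flow with resetting for active arcs `A` and
resetting arcs `R`. -/
structure IsThinFlow [Fintype E] (A R : Set E) (x : E → ℝ) (lam : V → ℝ) : Prop where
  flow : N.IsStaticFlow A x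
  source : lam N.s = 1
  isLeast : ∀ w, w ≠ N.s →
    IsLeast {r | ∃ e ∈ A, N.tgt e = w ∧ r = N.rho R e (lam (N.src e)) (x e)} (lam w)
  eq_of_pos : ∀ e ∈ A, 0 < x e → lam (N.tgt e) = N.rho R e (lam (N.src e)) (x e)

/-- `lam` is the vector of node labels of a thin flow at the labelling `ℓ`. -/
def IsThinFlowLabel [Fintype E] (ℓ lam : V → ℝ) : Prop :=
  ∃ x : E → ℝ, N.IsThinFlow (N.activeArcs ℓ) (N.resettingArcs ℓ) x lam

open Classical in
/-- The vector field `X`, mapping a feasible labelling `ℓ` to the thin flow labels at `ℓ`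
(these exist and are unique on `Ω`; the value outside `Ω` plays no role). -/
def X [Fintype E] (ℓ : V → ℝ) : V → ℝ :=
  if h : ∃ lam, N.IsThinFlowLabel ℓ lam then h.choose else 0

/-- The set `𝓕_{ℓ₀}` of Nash (equilibrium) trajectories with initial labelling `ℓ₀`:
locally absolutely continuous curves in `Ω` on `[0, ∞)` starting at `ℓ₀` whose derivative
coincides with the vector field `X` at almost every time. Values at negative times are ignored. -/
structure IsNashTrajectory [Fintype E] (ℓ₀ : V → ℝ) (ℓ : ℝ → V → ℝ) : Prop where
  initial : ℓ 0 = ℓ₀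
  feasible : ∀ θ, 0 ≤ θ → ℓ θ ∈ N.feasibleLabellings
  absolutelyContinuous : ∀ T, 0 ≤ T → ∀ v,
    AbsolutelyContinuousOnInterval (fun θ => ℓ θ v) 0 T
  deriv_eq : ∀ᵐ θ ∂(volume.restrict (Ici (0 : ℝ))), ∀ v,
    HasDerivAt (fun ξ => ℓ ξ v) (N.X (ℓ θ) v) θ

end FlowNetwork

/-- Distance in `ℝ^V` with respect to the `1`-norm. -/
def l1dist {V : Type*} [Fintype V] (a b : V → ℝ) : ℝ := ∑ v, |a v - b v|

end

/-! ### Absolutely continuous functions of a real variable -/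

/-! The field `X` depends on `ℓ` only through the active and resetting arcs, so it takes finitely
many values but is discontinuous, and no Gronwall argument applies. Stability comes instead from a
`potential` Φ attached to `ℓ₀`. It is nonpositive everywhere (`potential_nonpos`: test it against
the thin flow at `ℓ₀`), it is at least `-K * d` within distance `d` of `ℓ₀` (`exists_potential_ge`),
and it does not decrease along Nash trajectories near `ℓ₀` (`rate_nonneg`).

Monotonicity is an entropy inequality. With `μ v = X ℓ v / X ℓ₀ v` and the thin flow `x` at `ℓ`,
flow conservation applied to `log μ` splits the rate of Φ into `u₀ * (μ t - 1 - log μ t)` plus one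
term per arc, and all of these are nonnegative by `a - b ≤ a * (log a - log b)`. This uses that at
almost every time the queue of an active, non-resetting arc has derivative zero. If the rate
vanishes, then `μ ≥ 1`, and `X ℓ` agrees with `X ℓ₀` in the relations along arcs that determine the
labels.

As there are only finitely many arc configurations, any quantity depending on them alone that is
nonpositive whenever the rate vanishes is at most a constant times the rate. Integrating
(`exists_comparison`), a function with such a derivative grows by at most a constant times Φ(T) -
Φ(0), hence by a constant times `d`. Applied to `X ℓ₀ v - X ℓ v` this bounds trajectories from
below; applied along the tight arcs of the thin flow at `ℓ₀`, by induction from the source, it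
bounds them from above. The deviation from the linear motion is thus linear in the initial distance.

The reference trajectory rests on existence and uniqueness of thin flow labels, on the fact that
moving linearly with slope `X ℓ` preserves the thin flow for a short time, and on Zorn's lemma. -/

lemma AbsolutelyContinuousOnInterval.max_zero {f : ℝ → ℝ} {a b : ℝ}
    (hf : AbsolutelyContinuousOnInterval f a b) :
    AbsolutelyContinuousOnInterval (fun θ => max (f θ) 0) a b := by
  refine squeeze_zero (fun t => Finset.sum_nonneg fun i _ => dist_nonneg)
    (fun t => Finset.sum_le_sum fun i _ => ?_) hf
  simp only [Real.dist_eq]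
  exact abs_max_sub_max_le_abs _ _ _

lemma AbsolutelyContinuousOnInterval.of_const (c a b : ℝ) :
    AbsolutelyContinuousOnInterval (fun _ => c) a b :=
  (LipschitzWith.const c).lipschitzOnWith.absolutelyContinuousOnInterval

lemma AbsolutelyContinuousOnInterval.finset_sum {ι : Type*} (s : Finset ι) {f : ι → ℝ → ℝ}
    {a b : ℝ} (hf : ∀ i ∈ s, AbsolutelyContinuousOnInterval (f i) a b) :
    AbsolutelyContinuousOnInterval (fun θ => ∑ i ∈ s, f i θ) a b := by
  classical
  induction s using Finset.induction_on with
  | empty => simpa using AbsolutelyContinuousOnInterval.of_const 0 a b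
  | insert i s hi ih =>
    simp only [Finset.sum_insert hi]
    exact (hf i (Finset.mem_insert_self i s)).add
      (ih fun j hj => hf j (Finset.mem_insert_of_mem hj))

lemma AbsolutelyContinuousOnInterval.le_of_ae_hasDerivAt_nonneg {f : ℝ → ℝ} {a b : ℝ}
    (hab : a ≤ b) (hf : AbsolutelyContinuousOnInterval f a b)
    (hd : ∀ᵐ θ : ℝ, θ ∈ Icc a b → ∃ d, 0 ≤ d ∧ HasDerivAt f d θ) : f a ≤ f b := by
  rw [← sub_nonneg, ← hf.integral_deriv_eq_sub]
  refine intervalIntegral.integral_nonneg_of_ae_restrict hab ?_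
  filter_upwards [(ae_restrict_iff' measurableSet_Icc).mpr hd] with θ hθ
  obtain ⟨d, hd0, hd⟩ := hθ
  rw [hd.deriv]
  exact hd0

/-- A zero with nonzero derivative is isolated from the right in the zero set, and a set of reals
has only countably many such points. -/
lemma ae_hasDerivAt_eq_zero (q : ℝ → ℝ) :
    ∀ᵐ θ : ℝ, q θ = 0 → ∀ d, HasDerivAt q d θ → d = 0 := by
  have hc := countable_setOfPred_isolated_right_within (s := {θ | q θ = 0})
  filter_upwards [hc.ae_notMem volume] with θ hθ hq d hd
  by_contra hne
  refine hθ ⟨hq, ?_⟩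
  have hev := hd.eventually_ne (c := 0) hne
  have : ∀ᶠ ξ in nhdsWithin θ ({θ | q θ = 0} ∩ Ioi θ), False := by
    have h1 : ∀ᶠ ξ in nhdsWithin θ ({θ | q θ = 0} ∩ Ioi θ), q ξ ≠ 0 :=
      hev.filter_mono (nhdsWithin_mono θ fun ξ hξ => (ne_of_gt hξ.2 : ξ ≠ θ))
    filter_upwards [h1, self_mem_nhdsWithin] with ξ h2 h3
    exact h2 h3.1
  exact Filter.eventually_false_iff_eq_bot.mp this

open Classical in
lemma HasDerivAt.max_zero {q : ℝ → ℝ} {d θ : ℝ} (hq : HasDerivAt q d θ)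
    (h : q θ = 0 → d = 0) :
    HasDerivAt (fun ξ => max (q ξ) 0) (if 0 < q θ then d else 0) θ := by
  rcases lt_trichotomy (q θ) 0 with hlt | heq | hgt
  · rw [if_neg (not_lt.mpr hlt.le)]
    refine (hasDerivAt_const θ (0 : ℝ)).congr_of_eventuallyEq ?_
    filter_upwards [hq.continuousAt.eventually_lt_const hlt] with ξ hξ
    exact max_eq_right hξ.le
  · rw [if_neg (by rw [heq]; exact lt_irrefl _)]
    rw [h heq] at hq
    rw [hasDerivAt_iff_isLittleO] at hq ⊢
    refine Asymptotics.IsBigO.trans_isLittleO (Asymptotics.IsBigO.of_bound 1 ?_) hq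
    refine Filter.Eventually.of_forall fun ξ => ?_
    simp only [heq, smul_zero, sub_zero, max_self, one_mul, Real.norm_eq_abs]
    simpa using abs_max_sub_max_le_abs (q ξ) 0 0
  · rw [if_pos hgt]
    refine hq.congr_of_eventuallyEq ?_
    filter_upwards [hq.continuousAt.eventually_const_lt hgt] with ξ hξ
    exact max_eq_left hξ.le

/-! ### Entropy inequalities for the logarithm -/

lemma Real.sub_le_mul_log_sub_log {a b : ℝ} (ha : 0 < a) (hb : 0 < b) :
    a - b ≤ a * (Real.log a - Real.log b) := by
  have h := Real.log_le_sub_one_of_pos (div_pos hb ha)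
  rw [Real.log_div hb.ne' ha.ne'] at h
  have h1 : a * (Real.log b - Real.log a) ≤ a * (b / a - 1) := mul_le_mul_of_nonneg_left h ha.le
  have h2 : a * (b / a - 1) = b - a := by field_simp
  linarith

lemma Real.sub_lt_mul_log_sub_log {a b : ℝ} (ha : 0 < a) (hb : 0 < b) (hab : a ≠ b) :
    a - b < a * (Real.log a - Real.log b) := by
  have h := Real.log_lt_sub_one_of_pos (div_pos hb ha) fun h => hab (by
    rw [div_eq_one_iff_eq ha.ne'] at h; exact h.symm)
  rw [Real.log_div hb.ne' ha.ne'] at h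
  have h1 : a * (Real.log b - Real.log a) < a * (b / a - 1) := mul_lt_mul_of_pos_left h ha
  have h2 : a * (b / a - 1) = b - a := by field_simp
  linarith

/-! ### Admissible arc sets, coupled flows and summation by parts -/

noncomputable section

namespace FlowNetwork

open Classical

variable {V E : Type*} (N : FlowNetwork V E)

/-- Net inflow of the arc vector `x` at the node `v`. -/
def excess [Fintype E] (x : E → ℝ) (v : V) : ℝ :=
  (∑ e with N.tgt e = v, x e) - ∑ e with N.src e = v, x e

/-- The net inflow that a static source-sink flow has at the node `v`. -/
def demand (v : V) : ℝ :=
  if v = N.s then -N.u₀ else if v = N.t then N.u₀ else 0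

/-- `b` is the head of an arc of `A` with tail `a`. -/
def Step (A : Set E) (a b : V) : Prop := ∃ e ∈ A, N.src e = a ∧ N.tgt e = b

/-- The combinatorial properties of the active and resetting arcs of a feasible labelling. -/
structure IsAdmissiblePair (A R : Set E) : Prop where
  subset : R ⊆ A
  acyclic : ∀ v, ¬ Relation.TransGen (N.Step A) v v
  reach : ∀ v, Relation.ReflTransGen (N.Step A) N.s v
  reset_reach : ∀ e ∈ R, Relation.ReflTransGen (N.Step A) (N.tgt e) N.t

/-- The complementarity conditions that couple arc flows and node labels of a thin flow. -/
structure IsCoupled (A R : Set E) (x : E → ℝ) (lam : V → ℝ) : Prop where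
  off : ∀ e, e ∉ A → x e = 0
  nonneg : ∀ e, 0 ≤ x e
  le : ∀ e, x e ≤ N.ν e * lam (N.tgt e)
  reset : ∀ e ∈ R, x e = N.ν e * lam (N.tgt e)
  full : ∀ e ∈ A, lam (N.src e) < lam (N.tgt e) → x e = N.ν e * lam (N.tgt e)
  zero : ∀ e ∈ A, e ∉ R → lam (N.tgt e) < lam (N.src e) → x e = 0

/-- Coupled flows and labels whose net inflow is nowhere larger than demanded. -/
structure IsSubsolution [Fintype E] (A R : Set E) (x : E → ℝ) (lam : V → ℝ) : Prop where
  source : lam N.s = 1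
  lam_nonneg : ∀ v, 0 ≤ lam v
  coupled : N.IsCoupled A R x lam
  excess_le : ∀ v, v ≠ N.s → N.excess x v ≤ N.demand v

variable {N}

lemma sum_mul_excess [Fintype V] [Fintype E] (x : E → ℝ) (c : V → ℝ) :
    ∑ v, c v * N.excess x v = ∑ e, x e * (c (N.tgt e) - c (N.src e)) := by
  have key : ∀ f : E → V, ∑ v, c v * ∑ e with f e = v, x e = ∑ e, x e * c (f e) := by
    intro f
    rw [← Finset.sum_fiberwise Finset.univ f]
    refine Finset.sum_congr rfl fun v _ => ?_
    rw [Finset.mul_sum]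
    refine Finset.sum_congr rfl fun e he => ?_
    rw [(Finset.mem_filter.mp he).2, mul_comm]
  simp only [excess, mul_sub, Finset.sum_sub_distrib, key]

lemma sum_mul_demand [Fintype V] (c : V → ℝ) :
    ∑ v, c v * N.demand v = N.u₀ * (c N.t - c N.s) := by
  have h : ∀ v, c v * N.demand v =
      (if v = N.t then c v * N.u₀ else 0) - (if v = N.s then c v * N.u₀ else 0) := by
    intro v
    have := N.s_ne_t
    unfold demand
    by_cases h1 : v = N.s <;> by_cases h2 : v = N.t <;> simp_all
  simp only [h, Finset.sum_sub_distrib, Finset.sum_ite_eq', Finset.mem_univ, if_true]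
  ring

lemma IsStaticFlow.excess_eq [Fintype E] {A : Set E} {x : E → ℝ} (h : N.IsStaticFlow A x)
    (v : V) : N.excess x v = N.demand v := by
  have h1 := h.conservation v
  unfold excess demand
  split_ifs at h1 ⊢ <;> linarith

lemma IsStaticFlow.sum_mul_sub [Fintype V] [Fintype E] {A : Set E} {x : E → ℝ}
    (h : N.IsStaticFlow A x) (c : V → ℝ) :
    ∑ e, x e * (c (N.tgt e) - c (N.src e)) = N.u₀ * (c N.t - c N.s) := by
  rw [← sum_mul_excess, ← sum_mul_demand]
  simp only [h.excess_eq]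

lemma IsAdmissiblePair.tgt_ne_source {A R : Set E} (h : N.IsAdmissiblePair A R) {e : E}
    (he : e ∈ A) : N.tgt e ≠ N.s := fun hs =>
  h.acyclic N.s (Relation.TransGen.tail' (h.reach (N.src e)) ⟨e, he, rfl, hs⟩)

lemma exists_step_into {A : Set E} {a b : V} (h : Relation.ReflTransGen (N.Step A) a b)
    {U : Set V} (ha : a ∉ U) (hb : b ∈ U) : ∃ e ∈ A, N.src e ∉ U ∧ N.tgt e ∈ U := by
  induction h with
  | refl => exact absurd hb ha
  | @tail c d _ hcd ih =>
    by_cases hc : c ∈ U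
    · exact ih hc
    · obtain ⟨e, he, rfl, rfl⟩ := hcd
      exact ⟨e, he, hc, hb⟩

lemma IsAdmissiblePair.wellFounded [Finite V] {A R : Set E} (h : N.IsAdmissiblePair A R) :
    WellFounded (Relation.TransGen (N.Step A)) :=
  haveI : Std.Irrefl (Relation.TransGen (N.Step A)) := ⟨h.acyclic⟩
  Finite.wellFounded_of_trans_of_irrefl _

/-- Induction along the arcs of an acyclic arc set: if every node other than the source has an
entering arc along which the property is inherited, then it holds at all nodes. -/
lemma IsAdmissiblePair.induction [Finite V] {A R : Set E} (h : N.IsAdmissiblePair A R)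
    {P : V → Prop} (hs : P N.s)
    (hstep : ∀ w, w ≠ N.s → ∃ e ∈ A, N.tgt e = w ∧ (P (N.src e) → P w)) (v : V) : P v := by
  induction v using h.wellFounded.induction with
  | _ w ih =>
    by_cases hw : w = N.s
    · exact hw ▸ hs
    · obtain ⟨e, he, hew, hP⟩ := hstep w hw
      exact hP (ih _ (Relation.TransGen.single ⟨e, he, rfl, hew⟩))

/-! ### Bounds for subsolutions -/

/-- Cut at the set of nodes with label above `a`, which misses the source. Some arc of `A` enters it
and is full, so its flow is its capacity times its head label. Flow leaving the set ends at labels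
at most `a` and is bounded by `a` times the total capacity, and the net inflow is at most `u₀`. -/
lemma IsSubsolution.exists_le_of_lt [Fintype V] [Fintype E] {A R : Set E}
    (h : N.IsAdmissiblePair A R) {C : ℝ} (hC : ∀ e, N.u₀ ≤ C * N.ν e ∧ ∑ e, N.ν e ≤ C * N.ν e)
    {x : E → ℝ} {lam : V → ℝ} (hx : N.IsSubsolution A R x lam) {a : ℝ} (ha : 1 ≤ a)
    {v : V} (hv : a < lam v) : ∃ w, a < lam w ∧ lam w ≤ C * (1 + a) := by
  have hsU : N.s ∉ {v | a < lam v} := by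
    simp only [Set.mem_ofPred_eq, hx.source]; linarith
  obtain ⟨e₀, he₀, h1, h2⟩ := exists_step_into (h.reach v) hsU hv
  refine ⟨_, h2, ?_⟩
  simp only [Set.mem_ofPred_eq] at h1 h2
  let c : V → ℝ := fun v => if a < lam v then 1 else 0
  have hsum : ∑ v, c v * N.excess x v ≤ ∑ v, c v * N.demand v := by
    refine Finset.sum_le_sum fun v _ => ?_
    by_cases hvU : a < lam v
    · have : v ≠ N.s := by rintro rfl; exact hsU hvU
      simpa [c, hvU] using hx.excess_le v this
    · simp [c, hvU]
  rw [sum_mul_excess, sum_mul_demand] at hsum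
  have hcs : c N.s = 0 := if_neg hsU
  have hct : c N.t ≤ 1 := by simp only [c]; split_ifs <;> norm_num
  have hu := N.u₀_pos
  have hterm : ∀ e, (if e = e₀ then N.ν e * lam (N.tgt e) else 0) - N.ν e * a
      ≤ x e * (c (N.tgt e) - c (N.src e)) := by
    intro e
    have hνe := N.ν_pos e
    have hxe := hx.coupled.nonneg e
    by_cases he : e = e₀
    · subst he
      have : x e = N.ν e * lam (N.tgt e) :=
        hx.coupled.full e he₀ (lt_of_le_of_lt (not_lt.mp h1) h2)
      simp only [c, h1, h2, if_true, if_false, this]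
      nlinarith
    · simp only [he, if_false, c]
      by_cases hs : a < lam (N.src e) <;> by_cases ht : a < lam (N.tgt e) <;>
        simp only [hs, ht, if_true, if_false]
      · nlinarith
      · have := hx.coupled.le e
        nlinarith [not_lt.mp ht]
      · nlinarith
      · nlinarith
  have h3 := Finset.sum_le_sum fun e (_ : e ∈ Finset.univ) => hterm e
  rw [Finset.sum_sub_distrib, ← Finset.sum_mul] at h3
  simp only [Finset.sum_ite_eq', Finset.mem_univ, if_true] at h3
  have h4 : N.ν e₀ * lam (N.tgt e₀) ≤ N.u₀ + (∑ e, N.ν e) * a := by nlinarith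
  obtain ⟨h5, h6⟩ := hC e₀
  have h7 : N.ν e₀ * lam (N.tgt e₀) ≤ N.ν e₀ * (C * (1 + a)) := by nlinarith
  exact le_of_mul_le_mul_left h7 (N.ν_pos e₀)

variable (N) in
lemma exists_ratio_bound [Fintype E] :
    ∃ C : ℝ, 1 ≤ C ∧ ∀ e, N.u₀ ≤ C * N.ν e ∧ ∑ e, N.ν e ≤ C * N.ν e := by
  have hν : 0 ≤ ∑ e, N.ν e := Finset.sum_nonneg fun e _ => (N.ν_pos e).le
  have hu := N.u₀_pos
  refine ⟨1 + ∑ e, (N.u₀ + ∑ e, N.ν e) / N.ν e, ?_, fun e => ?_⟩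
  · have : 0 ≤ ∑ e, (N.u₀ + ∑ e, N.ν e) / N.ν e :=
      Finset.sum_nonneg fun e _ => div_nonneg (by linarith) (N.ν_pos e).le
    linarith
  · have h1 : (N.u₀ + ∑ e, N.ν e) / N.ν e ≤ ∑ e, (N.u₀ + ∑ e, N.ν e) / N.ν e :=
      Finset.single_le_sum (f := fun e => (N.u₀ + ∑ e, N.ν e) / N.ν e)
        (fun e _ => div_nonneg (by linarith) (N.ν_pos e).le) (Finset.mem_univ e)
    have h2 := N.ν_pos e
    rw [div_le_iff₀ h2] at h1
    constructor <;> nlinarith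

lemma exists_lam_bound [Fintype V] [Fintype E] {A R : Set E} (h : N.IsAdmissiblePair A R) :
    ∃ B : ℝ, ∀ x lam, N.IsSubsolution A R x lam → ∀ v, lam v ≤ B := by
  obtain ⟨C, hC1, hC⟩ := N.exists_ratio_bound
  let φ : ℝ → ℝ := fun a => C * (1 + a)
  have hφ : ∀ k, 1 ≤ φ^[k] 1 := by
    intro k
    induction k with
    | zero => simp
    | succ k ih =>
      rw [Function.iterate_succ_apply']
      simp only [φ] at ih ⊢
      nlinarith
  have hmono : ∀ k, φ^[k] 1 ≤ φ^[k + 1] 1 := by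
    intro k
    rw [Function.iterate_succ_apply']
    have := hφ k
    simp only [φ] at this ⊢
    nlinarith
  refine ⟨φ^[Fintype.card V] 1, fun x lam hx => ?_⟩
  -- Each threshold captures at least one node beyond those below the previous one, so after as many
  -- steps as there are nodes no label is left above.
  have key : ∀ k, (∀ v, lam v ≤ φ^[k] 1) ∨ k + 1 ≤ (Finset.univ.filter fun v => lam v ≤ φ^[k] 1).card := by
    intro k
    induction k with
    | zero =>
      right
      exact Finset.card_pos.mpr ⟨N.s, Finset.mem_filter.mpr ⟨Finset.mem_univ _, hx.source.le⟩⟩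
    | succ k ih =>
      by_cases hall : ∀ v, lam v ≤ φ^[k] 1
      · exact Or.inl fun v => (hall v).trans (hmono k)
      · right
        have hcard := ih.resolve_left hall
        push Not at hall
        obtain ⟨v, hv⟩ := hall
        obtain ⟨w, hw1, hw2⟩ := hx.exists_le_of_lt h hC (hφ k) hv
        have hlt : (Finset.univ.filter fun v => lam v ≤ φ^[k] 1).card <
            (Finset.univ.filter fun v => lam v ≤ φ^[k + 1] 1).card := by
          refine Finset.card_lt_card (Finset.ssubset_iff_of_subset ?_ |>.mpr ⟨w, ?_, ?_⟩)
          · intro u hu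
            simp only [Finset.mem_filter, Finset.mem_univ, true_and] at hu ⊢
            exact hu.trans (hmono k)
          · simp only [Finset.mem_filter, Finset.mem_univ, true_and]
            rw [Function.iterate_succ_apply']; exact hw2
          · simpa using hw1
        omega
  refine (key _).resolve_right fun hcard => ?_
  have := Finset.card_le_univ (Finset.univ.filter fun v => lam v ≤ φ^[Fintype.card V] 1)
  omega

lemma isSubsolution_zero [Fintype E] {A R : Set E} (h : N.IsAdmissiblePair A R) :
    N.IsSubsolution A R 0 (fun v => if v = N.s then 1 else 0) where
  source := if_pos rfl
  lam_nonneg v := by split_ifs <;> norm_num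
  excess_le v hv := by
    have := N.u₀_pos
    simp only [excess, demand, Pi.zero_apply, Finset.sum_const_zero, hv, if_false, sub_zero]
    split_ifs <;> linarith
  coupled := by
    refine ⟨fun _ _ => rfl, fun _ => le_rfl, fun e => ?_, fun e he => ?_, fun e he hlt => ?_,
      fun _ _ _ _ => rfl⟩
    · have := N.ν_pos e
      simp only [Pi.zero_apply]
      split_ifs <;> linarith
    · simp [h.tgt_ne_source (h.subset he)]
    · simp [h.tgt_ne_source he]

/-- The conditional clauses of `IsCoupled` have strict inequalities as premises, which persist near
a limit; this makes the set closed. -/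
lemma isCompact_subsolutions [Fintype V] [Fintype E] {A R : Set E}
    (h : N.IsAdmissiblePair A R) :
    IsCompact {p : (E → ℝ) × (V → ℝ) | N.IsSubsolution A R p.1 p.2} := by
  obtain ⟨B, hB⟩ := exists_lam_bound h
  refine IsCompact.of_isClosed_subset (isCompact_Icc (a := ((0 : E → ℝ), (0 : V → ℝ)))
    (b := (fun e => N.ν e * B, fun _ => B))) (IsSeqClosed.isClosed ?_) ?_
  · intro p q hp hpq
    have hx : ∀ e, Filter.Tendsto (fun n => (p n).1 e) Filter.atTop (nhds (q.1 e)) := fun e =>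
      ((continuous_apply e).comp continuous_fst).continuousAt.tendsto.comp hpq
    have hl : ∀ v, Filter.Tendsto (fun n => (p n).2 v) Filter.atTop (nhds (q.2 v)) := fun v =>
      ((continuous_apply v).comp continuous_snd).continuousAt.tendsto.comp hpq
    have hνl : ∀ e, Filter.Tendsto (fun n => N.ν e * (p n).2 (N.tgt e)) Filter.atTop
      (nhds (N.ν e * q.2 (N.tgt e))) := fun e => (hl _).const_mul _
    refine ⟨?_, fun v => ge_of_tendsto' (hl v) fun n => (hp n).lam_nonneg v, ⟨fun e he => ?_,
      fun e => ge_of_tendsto' (hx e) fun n => (hp n).coupled.nonneg e,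
      fun e => le_of_tendsto_of_tendsto' (hx e) (hνl e) fun n => (hp n).coupled.le e,
      fun e he => ?_, fun e he hlt => ?_, fun e he heR hlt => ?_⟩, fun v hv => ?_⟩
    · exact tendsto_nhds_unique ((hl N.s).congr fun n => (hp n).source) tendsto_const_nhds
    · exact tendsto_nhds_unique ((hx e).congr fun n => (hp n).coupled.off e he)
        tendsto_const_nhds
    · exact tendsto_nhds_unique ((hx e).congr fun n => (hp n).coupled.reset e he) (hνl e)
    · refine tendsto_nhds_unique ((hx e).congr' ?_) (hνl e)
      filter_upwards [(hl _).eventually_lt (hl _) hlt] with n hn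
      exact (hp n).coupled.full e he hn
    · refine tendsto_nhds_unique ((hx e).congr' ?_) tendsto_const_nhds
      filter_upwards [(hl _).eventually_lt (hl _) hlt] with n hn
      exact (hp n).coupled.zero e he heR hn
    · refine le_of_tendsto' (x := Filter.atTop) (f := fun n => N.excess (p n).1 v) ?_
        fun n => (hp n).excess_le v hv
      exact (tendsto_finsetSum _ fun e _ => hx e).sub (tendsto_finsetSum _ fun e _ => hx e)
  · rintro ⟨x, lam⟩ hp
    have hp : N.IsSubsolution A R x lam := hp
    refine ⟨⟨fun e => hp.coupled.nonneg e, fun v => hp.lam_nonneg v⟩, ⟨fun e => ?_, fun v => ?_⟩⟩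
    · exact (hp.coupled.le e).trans (mul_le_mul_of_nonneg_left (hB _ _ hp _) (N.ν_pos e).le)
    · exact hB _ _ hp _

/-! ### Existence of thin flows -/

lemma excess_add_mul [Fintype E] (x g : E → ℝ) (ε : ℝ) (v : V) :
    N.excess (fun e => x e + ε * g e) v = N.excess x v + ε * N.excess g v := by
  simp only [excess, Finset.sum_add_distrib, ← Finset.mul_sum]
  ring

lemma excess_update [Fintype E] (x : E → ℝ) (e : E) (d : ℝ) (v : V) :
    N.excess (Function.update x e (x e + d)) v =
      N.excess x v + d * ((if v = N.tgt e then 1 else 0) - if v = N.src e then 1 else 0) := by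
  have h1 : Function.update x e (x e + d) = fun a => x a + d * (if a = e then 1 else 0) := by
    funext a
    by_cases h : a = e
    · subst h; simp
    · simp [h]
  rw [h1, excess_add_mul]
  congr 2
  simp only [excess, Finset.sum_ite_eq', Finset.mem_filter, Finset.mem_univ, true_and]
  simp only [eq_comm]

/-- Labels of a subsolution can be raised on a set `Z` of nodes if every node of `Z` either has
slack or only has entering arcs coming from strictly larger labels, and if arcs between `Z` and
its complement whose end nodes have equal labels do not obstruct. -/
lemma IsSubsolution.exists_raise [Fintype V] [Fintype E] {A R : Set E} (hRA : R ⊆ A)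
    {x : E → ℝ} {lam : V → ℝ} (hx : N.IsSubsolution A R x lam) {Z : Set V} (hsZ : N.s ∉ Z)
    (hZ : Z.Nonempty)
    (hin : ∀ e ∈ A, e ∉ R → N.src e ∉ Z → N.tgt e ∈ Z → lam (N.src e) = lam (N.tgt e) →
      x e = N.ν e * lam (N.tgt e))
    (hout : ∀ e ∈ A, e ∉ R → N.src e ∈ Z → N.tgt e ∉ Z → lam (N.src e) = lam (N.tgt e) →
      x e = 0)
    (hslack : ∀ v ∈ Z, N.excess x v < N.demand v ∨
      ∀ e ∈ A, N.tgt e = v → e ∉ R ∧ lam (N.tgt e) < lam (N.src e)) :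
    ∃ x' lam', N.IsSubsolution A R x' lam' ∧ ∑ v, lam v < ∑ v, lam' v := by
  -- These arcs into `Z` carry flow equal to capacity times head label and must keep doing so when
  -- the head label rises by `ε`; all other flows stay fixed. Here `ε` is small enough to preserve
  -- strict label inequalities and strict slack.
  let F : Set E := {e | e ∈ A ∧ N.tgt e ∈ Z ∧
    (e ∈ R ∨ lam (N.src e) ≤ lam (N.tgt e) ∧ x e = N.ν e * lam (N.tgt e))}
  let g : E → ℝ := fun e => if e ∈ F then N.ν e else 0
  have hg0 : ∀ e, 0 ≤ g e := fun e => by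
    have := N.ν_pos e
    simp only [g]; split_ifs <;> linarith
  have hgle : ∀ v, (∀ e, N.tgt e = v → g e = 0) → N.excess g v ≤ 0 := by
    intro v hv
    have h1 : ∑ e with N.tgt e = v, g e = 0 :=
      Finset.sum_eq_zero fun e he => hv e (Finset.mem_filter.mp he).2
    have h2 : 0 ≤ ∑ e with N.src e = v, g e := Finset.sum_nonneg fun e _ => hg0 e
    unfold excess; linarith
  have hsmall : ∀ a b c : ℝ, a < b → ∀ᶠ ε in nhdsWithin (0 : ℝ) (Ioi 0), a + ε * c < b := by
    intro a b c hab
    have : Filter.Tendsto (fun ε : ℝ => a + ε * c) (nhdsWithin 0 (Ioi 0)) (nhds (a + 0 * c)) :=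
      ((continuous_const.add (continuous_id.mul continuous_const)).tendsto 0).mono_left
        nhdsWithin_le_nhds
    exact this.eventually_lt_const (by simpa using hab)
  obtain ⟨ε, hε0, hε1, hε2⟩ : ∃ ε : ℝ, 0 < ε ∧ (∀ u v, lam u < lam v → lam u + ε * 1 < lam v) ∧
      ∀ v, N.excess x v < N.demand v → N.excess x v + ε * N.excess g v < N.demand v := by
    have e1 : ∀ᶠ ε in nhdsWithin (0 : ℝ) (Ioi 0), ∀ u v, lam u < lam v → lam u + ε * 1 < lam v := by
      refine Filter.eventually_all.mpr fun u => Filter.eventually_all.mpr fun v => ?_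
      by_cases h : lam u < lam v
      · filter_upwards [hsmall _ _ 1 h] with ε hε _ using hε
      · exact Filter.Eventually.of_forall fun _ h' => absurd h' h
    have e2 : ∀ᶠ ε in nhdsWithin (0 : ℝ) (Ioi 0), ∀ v, N.excess x v < N.demand v →
        N.excess x v + ε * N.excess g v < N.demand v := by
      refine Filter.eventually_all.mpr fun v => ?_
      by_cases h : N.excess x v < N.demand v
      · filter_upwards [hsmall _ _ (N.excess g v) h] with ε hε _ using hε
      · exact Filter.Eventually.of_forall fun _ h' => absurd h' h
    have e0 : ∀ᶠ ε in nhdsWithin (0 : ℝ) (Ioi 0), 0 < ε := self_mem_nhdsWithin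
    obtain ⟨ε, h⟩ := (e0.and (e1.and e2)).exists
    exact ⟨ε, h.1, h.2.1, h.2.2⟩
  simp only [mul_one] at hε1
  let lam' : V → ℝ := fun v => lam v + if v ∈ Z then ε else 0
  have hlamZ : ∀ v ∈ Z, lam' v = lam v + ε := fun v hv => by simp [lam', hv]
  have hlamZ' : ∀ v, v ∉ Z → lam' v = lam v := fun v hv => by simp [lam', hv]
  have hlam_le : ∀ v, lam v ≤ lam' v := fun v => by
    simp only [lam']; split_ifs <;> linarith
  have hlam_le' : ∀ v, lam' v ≤ lam v + ε := fun v => by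
    simp only [lam']; split_ifs <;> linarith
  have hgF : ∀ e ∈ F, g e = N.ν e := fun e he => if_pos he
  have hgF' : ∀ e, e ∉ F → g e = 0 := fun e he => if_neg he
  have hcp := hx.coupled
  refine ⟨fun e => x e + ε * g e, lam', ⟨?_, fun v => (hx.lam_nonneg v).trans (hlam_le v),
    ⟨fun e he => ?_, fun e => ?_, fun e => ?_, fun e he => ?_, fun e he hlt => ?_,
      fun e he heR hlt => ?_⟩, fun v hv => ?_⟩, ?_⟩
  · rw [hlamZ' _ hsZ, hx.source]
  · have : e ∉ F := fun h => he h.1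
    simp [hgF' e this, hcp.off e he]
  · exact add_nonneg (hcp.nonneg e) (mul_nonneg hε0.le (hg0 e))
  · have h1 := hcp.le e
    have h2 := N.ν_pos e
    by_cases hF : e ∈ F
    · rw [hgF e hF, hlamZ _ hF.2.1]; nlinarith
    · rw [hgF' e hF]
      nlinarith [hlam_le (N.tgt e)]
  · by_cases ht : N.tgt e ∈ Z
    · rw [hgF e ⟨hRA he, ht, Or.inl he⟩, hlamZ _ ht, hcp.reset e he]; ring
    · rw [hgF' e fun h => ht h.2.1, hlamZ' _ ht, hcp.reset e he]; ring
  · by_cases ht : N.tgt e ∈ Z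
    · have hF : e ∈ F := by
        refine ⟨he, ht, ?_⟩
        by_cases heR : e ∈ R
        · exact Or.inl heR
        right
        rcases lt_trichotomy (lam (N.src e)) (lam (N.tgt e)) with h | h | h
        · exact ⟨h.le, hcp.full e he h⟩
        · refine ⟨h.le, hin e he heR (fun hs => ?_) ht h⟩
          rw [hlamZ _ hs, hlamZ _ ht, h] at hlt
          exact lt_irrefl _ hlt
        · have := hε1 _ _ h
          rw [hlamZ _ ht] at hlt
          linarith [hlam_le (N.src e)]
      have hfull : x e = N.ν e * lam (N.tgt e) := by
        rcases hF.2.2 with h | h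
        · exact hcp.reset e h
        · exact h.2
      rw [hgF e hF, hlamZ _ ht, hfull]; ring
    · rw [hlamZ' _ ht] at hlt ⊢
      rw [hgF' e fun h => ht h.2.1, hcp.full e he (lt_of_le_of_lt (hlam_le _) hlt)]; ring
  · by_cases ht : N.tgt e ∈ Z
    · rw [hlamZ _ ht] at hlt
      have h : lam (N.tgt e) < lam (N.src e) := by linarith [hlam_le' (N.src e)]
      have hF : e ∉ F := by
        rintro ⟨-, -, h' | h'⟩
        · exact heR h'
        · exact absurd h'.1 (not_le.mpr h)
      simp [hgF' e hF, hcp.zero e he heR h]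
    · rw [hlamZ' _ ht] at hlt
      have hF : e ∉ F := fun h => ht h.2.1
      rcases lt_trichotomy (lam (N.src e)) (lam (N.tgt e)) with h | h | h
      · linarith [hε1 _ _ h, hlam_le' (N.src e)]
      · have hs : N.src e ∈ Z := by
          by_contra hs
          rw [hlamZ' _ hs, h] at hlt
          exact lt_irrefl _ hlt
        simp [hgF' e hF, hout e he heR hs ht h]
      · simp [hgF' e hF, hcp.zero e he heR h]
  · rw [excess_add_mul]
    have hkey : N.excess g v ≤ 0 → N.excess x v + ε * N.excess g v ≤ N.demand v := fun h => by
      nlinarith [hx.excess_le v hv]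
    by_cases hvZ : v ∈ Z
    · rcases hslack v hvZ with h | h
      · exact (hε2 v h).le
      · refine hkey (hgle v fun e he => hgF' e ?_)
        rintro ⟨hA, -, h'⟩
        obtain ⟨h1, h2⟩ := h e hA he
        rcases h' with h' | h'
        · exact h1 h'
        · exact absurd h'.1 (not_le.mpr h2)
    · exact hkey (hgle v fun e he => hgF' e fun h => hvZ (he ▸ h.2.1))
  · obtain ⟨z, hz⟩ := hZ
    refine Finset.sum_lt_sum (fun v _ => hlam_le v) ⟨z, Finset.mem_univ _, ?_⟩
    rw [hlamZ z hz]; linarith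

lemma IsCoupled.update {A R : Set E} {x : E → ℝ} {lam : V → ℝ} (h : N.IsCoupled A R x lam)
    {e : E} (he : e ∈ A) (heR : e ∉ R) (htie : lam (N.src e) = lam (N.tgt e)) {y : ℝ}
    (h0 : 0 ≤ y) (h1 : y ≤ N.ν e * lam (N.tgt e)) :
    N.IsCoupled A R (Function.update x e y) lam := by
  refine ⟨fun a ha => ?_, fun a => ?_, fun a => ?_, fun a ha => ?_, fun a ha hlt => ?_,
    fun a ha haR hlt => ?_⟩ <;> by_cases hae : a = e
  · exact absurd (hae ▸ he) ha
  · simpa [hae] using h.off a ha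
  · simpa [hae] using h0
  · simpa [hae] using h.nonneg a
  · subst hae; simpa using h1
  · simpa [hae] using h.le a
  · exact absurd (hae ▸ ha) heR
  · simpa [hae] using h.reset a ha
  · subst hae; exact absurd htie hlt.ne
  · simpa [hae] using h.full a ha hlt
  · subst hae; exact absurd htie hlt.ne'
  · simpa [hae] using h.zero a ha haR hlt

/-- A subsolution with maximal total label, among these with maximal net outflow at the source,
and among these with the largest number of nodes with slack. -/
lemma exists_optimal_subsolution [Fintype V] [Fintype E] {A R : Set E}
    (h : N.IsAdmissiblePair A R) :
    ∃ x lam, N.IsSubsolution A R x lam ∧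
      (∀ x' lam', N.IsSubsolution A R x' lam' → ∑ v, lam' v ≤ ∑ v, lam v) ∧
      (∀ x', N.IsSubsolution A R x' lam → N.excess x N.s ≤ N.excess x' N.s) ∧
      (∀ x', N.IsSubsolution A R x' lam → N.excess x' N.s = N.excess x N.s →
        (Finset.univ.filter fun v => v ≠ N.s ∧ N.excess x' v < N.demand v).card ≤
        (Finset.univ.filter fun v => v ≠ N.s ∧ N.excess x v < N.demand v).card) := by
  have hK := isCompact_subsolutions h
  have hcont : Continuous fun p : (E → ℝ) × (V → ℝ) => ∑ v, p.2 v := by fun_prop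
  have hcont' : Continuous fun p : (E → ℝ) × (V → ℝ) => N.excess p.1 N.s := by
    unfold excess; fun_prop
  obtain ⟨p, hpK, hpmax⟩ := hK.exists_isMaxOn ⟨(_, _), isSubsolution_zero h⟩ hcont.continuousOn
  have hK1 : IsCompact ({q : (E → ℝ) × (V → ℝ) | N.IsSubsolution A R q.1 q.2} ∩ {q | q.2 = p.2}) :=
    hK.inter_right (isClosed_eq continuous_snd continuous_const)
  obtain ⟨q, ⟨hqK, hqp⟩, hqmin⟩ := hK1.exists_isMinOn ⟨p, hpK, rfl⟩ hcont'.continuousOn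
  let f : (E → ℝ) → ℕ := fun x =>
    (Finset.univ.filter fun v => v ≠ N.s ∧ N.excess x v < N.demand v).card
  have hf : ∀ x, f x ≤ Fintype.card V := fun x => Finset.card_le_univ _
  obtain ⟨x, ⟨hx, hxq⟩, hxmin⟩ := (measure fun x => Fintype.card V - f x).wf.has_min
    {x | N.IsSubsolution A R x p.2 ∧ N.excess x N.s = N.excess q.1 N.s} ⟨q.1, by
      have hqp : q.2 = p.2 := hqp
      have hqK : N.IsSubsolution A R q.1 q.2 := hqK
      exact ⟨hqp ▸ hqK, rfl⟩⟩
  refine ⟨x, p.2, hx, fun x' lam' h' => hpmax (a := (x', lam')) h', fun x' h' => ?_,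
    fun x' h' heq => ?_⟩
  · rw [hxq]
    exact hqmin (a := (x', p.2)) ⟨h', rfl⟩
  · have h1 : ¬ (Fintype.card V - f x' < Fintype.card V - f x) :=
      hxmin x' ⟨h', heq.trans hxq⟩
    have h2 := hf x
    have h3 := hf x'
    show f x' ≤ f x
    omega

/-- There are coupled flows and labels satisfying flow conservation such that every node other
than the source has an entering arc along which the label is tight. -/
lemma exists_coupled_flow [Fintype V] [Fintype E] {A R : Set E} (h : N.IsAdmissiblePair A R) :
    ∃ x lam, lam N.s = 1 ∧ N.IsCoupled A R x lam ∧ (∀ v, N.excess x v = N.demand v) ∧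
      ∀ w, w ≠ N.s → ∃ e ∈ A, N.tgt e = w ∧ (e ∈ R ∨ lam (N.src e) ≤ lam w) := by
  obtain ⟨x, lam, hx, hmax, hsrc, hcard⟩ := exists_optimal_subsolution h
  have hraise : ∀ Z : Set V, N.s ∉ Z → Z.Nonempty → _ → _ → _ → False :=
    fun Z h1 h2 h3 h4 h5 => by
      obtain ⟨x', lam', h6, h7⟩ := hx.exists_raise h.subset (Z := Z) h1 h2 h3 h4 h5
      exact absurd (hmax x' lam' h6) (not_le.mpr h7)
  let Z : Set V := {v | v ≠ N.s ∧ N.excess x v < N.demand v}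
  -- Moving a little excess from `u` outside `Z` to `w` in `Z` contradicts optimality: for `u` the
  -- source it lowers the excess there, otherwise `u` gains slack while `w` keeps its own.
  have htransfer : ∀ w ∈ Z, ∀ u, u ∉ Z → ∀ x' δ, 0 < δ → N.IsCoupled A R x' lam →
      N.excess x w + δ < N.demand w → (∀ v, N.excess x' v =
        N.excess x v + δ * ((if v = w then 1 else 0) - if v = u then 1 else 0)) → False := by
    intro w hw u hu x' δ hδ hcp hlt hex
    have hwu : w ≠ u := by rintro rfl; exact hu hw
    have hexw : N.excess x' w = N.excess x w + δ := by rw [hex]; simp [hwu]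
    have hexu : N.excess x' u = N.excess x u - δ := by rw [hex]; simp [hwu.symm]; ring
    have hexo : ∀ v, v ≠ w → v ≠ u → N.excess x' v = N.excess x v := fun v h1 h2 => by
      rw [hex]; simp [h1, h2]
    have hsub : N.IsSubsolution A R x' lam := by
      refine ⟨hx.source, hx.lam_nonneg, hcp, fun v hv => ?_⟩
      by_cases h1 : v = w
      · subst h1; linarith
      · by_cases h2 : v = u
        · subst h2; linarith [hx.excess_le v hv]
        · rw [hexo v h1 h2]; exact hx.excess_le v hv
    by_cases hus : u = N.s
    · subst hus
      linarith [hsrc x' hsub]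
    · have hle := hcard x' hsub (hexo _ (Ne.symm hw.1) (Ne.symm hus))
      refine absurd hle (not_le.mpr (Finset.card_lt_card
        ((Finset.ssubset_iff_of_subset ?_).mpr ⟨u, ?_, ?_⟩)))
      · intro v hv
        simp only [Finset.mem_filter, Finset.mem_univ, true_and] at hv ⊢
        refine ⟨hv.1, ?_⟩
        by_cases h1 : v = w
        · subst h1; linarith
        · by_cases h2 : v = u
          · subst h2; linarith
          · rw [hexo v h1 h2]; exact hv.2
      · simp only [Finset.mem_filter, Finset.mem_univ, true_and]
        exact ⟨hus, by linarith [hx.excess_le u hus]⟩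
      · simp only [Finset.mem_filter, Finset.mem_univ, true_and]
        exact hu
  -- An arc across the boundary of `Z` with tied labels that obstructed raising `Z` would allow such
  -- a transfer, so a nonempty `Z` could be raised, against maximality of the labels.
  have hZ : ∀ v, v ∉ Z := by
    by_contra hne
    push Not at hne
    refine hraise Z (fun hs => hs.1 rfl) hne ?_ ?_ fun v hv => Or.inl hv.2
    · intro e he heR hs ht htie
      refine le_antisymm (hx.coupled.le e) (le_of_not_gt fun hlt => ?_)
      obtain ⟨δ, hδ0, hδ⟩ := exists_between (lt_min (sub_pos.mpr hlt) (sub_pos.mpr ht.2))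
      obtain ⟨hδ1, hδ2⟩ := lt_min_iff.mp hδ
      have hxe := hx.coupled.nonneg e
      exact htransfer _ ht _ hs _ δ hδ0
        (hx.coupled.update he heR htie (y := x e + δ) (by linarith) (by linarith)) (by linarith)
        (excess_update x e δ)
    · intro e he heR hs ht htie
      refine le_antisymm (le_of_not_gt fun hlt => ?_) (hx.coupled.nonneg e)
      obtain ⟨δ, hδ0, hδ⟩ := exists_between (lt_min hlt (sub_pos.mpr hs.2))
      obtain ⟨hδ1, hδ2⟩ := lt_min_iff.mp hδ
      have hxe := hx.coupled.le e
      refine htransfer _ hs _ ht _ δ hδ0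
        (hx.coupled.update he heR htie (y := x e + -δ) (by linarith) (by linarith)) (by linarith)
        fun v => ?_
      rw [excess_update]; ring
  have hns : ∀ v, v ≠ N.s → N.excess x v = N.demand v := fun v hv =>
    le_antisymm (hx.excess_le v hv) (not_lt.mp fun hlt => hZ v ⟨hv, hlt⟩)
  have hex : ∀ v, N.excess x v = N.demand v := by
    intro v
    by_cases hv : v = N.s
    · have h1 : ∑ v, (1 : ℝ) * N.excess x v = 0 := by
        rw [sum_mul_excess x (fun _ => (1 : ℝ))]; simp
      have h2 : ∑ v, (1 : ℝ) * N.demand v = 0 := by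
        rw [sum_mul_demand (fun _ => (1 : ℝ))]; simp
      simp only [one_mul] at h1 h2
      rw [← Finset.add_sum_erase _ _ (Finset.mem_univ v)] at h1 h2
      have h3 : ∑ w ∈ Finset.univ.erase v, N.excess x w =
          ∑ w ∈ Finset.univ.erase v, N.demand w :=
        Finset.sum_congr rfl fun w hw => hns w (hv ▸ Finset.ne_of_mem_erase hw)
      linarith
    · exact hns v hv
  refine ⟨x, lam, hx.source, hx.coupled, hex, fun w hw => ?_⟩
  -- If every entering arc comes from a strictly larger label and none is resetting, `w` receives no
  -- flow, hence sends none, and `{w}` alone can be raised.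
  by_contra hno
  push Not at hno
  have hinz : ∀ e, N.tgt e = w → x e = 0 := by
    intro e he
    by_cases heA : e ∈ A
    · have := hno e heA he
      exact hx.coupled.zero e heA this.1 (he ▸ this.2)
    · exact hx.coupled.off e heA
  have houtz : ∀ e, N.src e = w → x e = 0 := by
    have h1 : ∑ e with N.tgt e = w, x e = 0 :=
      Finset.sum_eq_zero fun e he => hinz e (Finset.mem_filter.mp he).2
    have h2 : 0 ≤ N.demand w := by
      have := N.u₀_pos
      unfold demand; rw [if_neg hw]; split_ifs <;> linarith
    have h3 := hex w
    unfold excess at h3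
    have h4 : ∑ e with N.src e = w, x e = 0 :=
      le_antisymm (by linarith) (Finset.sum_nonneg fun e _ => hx.coupled.nonneg e)
    intro e he
    exact (Finset.sum_eq_zero_iff_of_nonneg fun e _ => hx.coupled.nonneg e).mp h4 e
      (by simp [he])
  refine hraise {w} (by simpa using Ne.symm hw) ⟨w, rfl⟩ ?_ ?_ ?_
  · intro e he heR hs ht htie
    have := hno e he ht
    rw [Set.mem_singleton_iff.mp ht] at htie
    exact absurd htie this.2.ne'
  · intro e he heR hs ht htie
    exact houtz e hs
  · rintro v rfl
    exact Or.inr fun e he hew => by simpa [hew] using hno e he hew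

lemma IsCoupled.isThinFlow [Fintype E] {A R : Set E} {x : E → ℝ} {lam : V → ℝ}
    (hcp : N.IsCoupled A R x lam) (hs : lam N.s = 1) (hex : ∀ v, N.excess x v = N.demand v)
    (htight : ∀ w, w ≠ N.s → ∃ e ∈ A, N.tgt e = w ∧ (e ∈ R ∨ lam (N.src e) ≤ lam w)) :
    N.IsThinFlow A R x lam := by
  refine ⟨⟨hcp.nonneg, hcp.off, fun v => ?_⟩, hs, fun w hw => ⟨?_, ?_⟩, ?_⟩
  · have := hex v
    unfold excess demand at this
    split_ifs at this ⊢ <;> linarith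
  · obtain ⟨e, he, rfl, hor⟩ := htight w hw
    have hν := N.ν_pos e
    refine ⟨e, he, rfl, ?_⟩
    unfold rho
    by_cases heR : e ∈ R
    · rw [if_pos heR, hcp.reset e heR, mul_div_cancel_left₀ _ hν.ne']
    · have hle := hor.resolve_left heR
      rw [if_neg heR]
      rcases hle.eq_or_lt with heq | hlt
      · rw [heq, max_eq_left]
        rw [div_le_iff₀ hν, mul_comm]; exact hcp.le e
      · rw [hcp.full e he hlt, mul_div_cancel_left₀ _ hν.ne', max_eq_right hle]
  · rintro r ⟨e, he, rfl, rfl⟩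
    have hν := N.ν_pos e
    unfold rho
    by_cases heR : e ∈ R
    · rw [if_pos heR, hcp.reset e heR, mul_div_cancel_left₀ _ hν.ne']
    · rw [if_neg heR]
      by_cases hlt : lam (N.src e) < lam (N.tgt e)
      · rw [hcp.full e he hlt, mul_div_cancel_left₀ _ hν.ne']
        exact le_max_right _ _
      · exact (not_lt.mp hlt).trans (le_max_left _ _)
  · intro e he hpos
    have hν := N.ν_pos e
    unfold rho
    by_cases heR : e ∈ R
    · rw [if_pos heR, hcp.reset e heR, mul_div_cancel_left₀ _ hν.ne']
    · rw [if_neg heR]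
      rcases lt_trichotomy (lam (N.src e)) (lam (N.tgt e)) with hlt | heq | hlt
      · rw [hcp.full e he hlt, mul_div_cancel_left₀ _ hν.ne', max_eq_right hlt.le]
      · rw [heq, max_eq_left]
        rw [div_le_iff₀ hν, mul_comm]; exact hcp.le e
      · exact absurd (hcp.zero e he heR hlt) hpos.ne'

theorem exists_isThinFlow [Fintype V] [Fintype E] {A R : Set E} (h : N.IsAdmissiblePair A R) :
    ∃ x lam, N.IsThinFlow A R x lam := by
  obtain ⟨x, lam, hs, hcp, hex, htight⟩ := exists_coupled_flow h
  exact ⟨x, lam, hcp.isThinFlow hs hex htight⟩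

/-! ### Uniqueness and positivity of thin flow labels -/

lemma IsThinFlow.lam_nonneg [Fintype E] {A R : Set E} {x : E → ℝ} {lam : V → ℝ}
    (ht : N.IsThinFlow A R x lam) (v : V) : 0 ≤ lam v := by
  by_cases hv : v = N.s
  · rw [hv, ht.source]; norm_num
  · obtain ⟨e, -, -, h⟩ := (ht.isLeast v hv).1
    have hq : 0 ≤ x e / N.ν e := div_nonneg (ht.flow.nonneg e) (N.ν_pos e).le
    rw [h, rho]
    split_ifs
    · exact hq
    · exact hq.trans (le_max_right _ _)

lemma IsThinFlow.isCoupled [Fintype E] {A R : Set E} (h : N.IsAdmissiblePair A R) {x : E → ℝ}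
    {lam : V → ℝ} (ht : N.IsThinFlow A R x lam) : N.IsCoupled A R x lam := by
  have hle : ∀ e, x e ≤ N.ν e * lam (N.tgt e) := by
    intro e
    have hν := N.ν_pos e
    rcases (ht.flow.nonneg e).eq_or_lt with h0 | hpos
    · rw [← h0]; exact mul_nonneg hν.le (ht.lam_nonneg _)
    · have he : e ∈ A := by
        by_contra he
        exact hpos.ne' (ht.flow.supported e he)
      have h1 : x e / N.ν e ≤ lam (N.tgt e) := by
        rw [ht.eq_of_pos e he hpos, rho]
        split_ifs
        · exact le_rfl
        · exact le_max_right _ _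
      rw [div_le_iff₀ hν] at h1
      linarith
  have hge : ∀ e ∈ A, lam (N.tgt e) ≤ N.rho R e (lam (N.src e)) (x e) := fun e he =>
    (ht.isLeast _ (h.tgt_ne_source he)).2 ⟨e, he, rfl, rfl⟩
  have hge' : ∀ e, lam (N.tgt e) ≤ x e / N.ν e → x e = N.ν e * lam (N.tgt e) := fun e h1 => by
    rw [le_div_iff₀ (N.ν_pos e)] at h1
    exact le_antisymm (hle e) (by linarith)
  refine ⟨ht.flow.supported, ht.flow.nonneg, hle, fun e he => ?_, fun e he hlt => ?_,
    fun e he heR hlt => ?_⟩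
  · have := hge e (h.subset he)
    rw [rho, if_pos he] at this
    exact hge' e this
  · have := hge e he
    rw [rho] at this
    split_ifs at this
    · exact hge' e this
    · exact hge' e ((le_max_iff.mp this).resolve_left (not_le.mpr hlt))
  · by_contra hne
    have := ht.eq_of_pos e he ((ht.flow.nonneg e).lt_of_ne' hne)
    rw [rho, if_neg heR] at this
    linarith [le_max_left (lam (N.src e)) (x e / N.ν e)]

lemma IsThinFlow.exists_tight [Fintype E] {A R : Set E} {x : E → ℝ}
    {lam : V → ℝ} (ht : N.IsThinFlow A R x lam) (w : V) (hw : w ≠ N.s) :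
    ∃ e ∈ A, N.tgt e = w ∧ (e ∈ R ∨ lam (N.src e) ≤ lam w) := by
  obtain ⟨e, he, hew, h⟩ := (ht.isLeast w hw).1
  refine ⟨e, he, hew, ?_⟩
  by_cases heR : e ∈ R
  · exact Or.inl heR
  · right
    rw [h, rho, if_neg heR]
    exact le_max_left _ _

/-- A node with label zero receives no flow, hence sends none; an arc of `A` from it to a positive
label would be full, so zero propagates along `A`. It cannot reach the sink, which receives `u₀`,
whereas heads of resetting arcs do reach the sink. Elsewhere positivity is inherited along a tight
arc. -/
lemma IsThinFlow.lam_pos [Finite V] [Fintype E] {A R : Set E} (h : N.IsAdmissiblePair A R)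
    {x : E → ℝ} {lam : V → ℝ} (ht : N.IsThinFlow A R x lam) (v : V) : 0 < lam v := by
  have hcp := ht.isCoupled h
  have hin : ∀ v, lam v = 0 → ∑ e with N.tgt e = v, x e = 0 := fun v hv =>
    Finset.sum_eq_zero fun e he => le_antisymm
      (by simpa [(Finset.mem_filter.mp he).2, hv] using hcp.le e) (hcp.nonneg e)
  have hout : ∀ v, 0 ≤ ∑ e with N.src e = v, x e := fun v =>
    Finset.sum_nonneg fun e _ => hcp.nonneg e
  have hzero : ∀ w, lam w = 0 → ¬ Relation.ReflTransGen (N.Step A) w N.t := by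
    intro w hw hreach
    have hlt : lam N.t = 0 := by
      generalize N.t = t at hreach
      induction hreach with
      | refl => exact hw
      | @tail b c _ hbc ih =>
        obtain ⟨e, he, rfl, rfl⟩ := hbc
        have hbs : N.src e ≠ N.s := fun hs => by
          rw [hs, ht.source] at ih; norm_num at ih
        have h1 : 0 ≤ N.demand (N.src e) := by
          have := N.u₀_pos
          unfold demand; rw [if_neg hbs]; split_ifs <;> linarith
        have h2 := ht.flow.excess_eq (N.src e)
        rw [excess, hin _ ih] at h2
        have h3 : ∑ a with N.src a = N.src e, x a = 0 :=
          le_antisymm (by linarith) (hout _)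
        have h4 : x e = 0 :=
          (Finset.sum_eq_zero_iff_of_nonneg fun e _ => hcp.nonneg e).mp h3 e (by simp)
        by_contra hne
        have hpos := (ht.lam_nonneg (N.tgt e)).lt_of_ne' hne
        have h5 := hcp.full e he (by rw [ih]; exact hpos)
        have := mul_pos (N.ν_pos e) hpos
        linarith
    have h2 := ht.flow.excess_eq N.t
    rw [excess, hin _ hlt, demand, if_neg N.s_ne_t.symm, if_pos rfl] at h2
    linarith [hout N.t, N.u₀_pos]
  induction v using h.induction with
  | hs => rw [ht.source]; norm_num
  | hstep w hw =>
    obtain ⟨e, he, hew, hor⟩ := ht.exists_tight w hw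
    refine ⟨e, he, hew, fun hpos => ?_⟩
    rcases hor with heR | hle
    · exact (ht.lam_nonneg w).lt_of_ne' fun h0 => hzero w h0 (hew ▸ h.reset_reach e heR)
    · exact hpos.trans_le hle

/-- Across the cut of nodes with `lam' < lam` both flows have the same net value, yet `x` is at
least `x'` on entering arcs and at most `x'` on leaving ones. So they agree on the cut, which fails
on an entering arc that is tight for `lam'`. -/
lemma IsThinFlow.lam_le [Fintype V] [Fintype E] {A R : Set E} (h : N.IsAdmissiblePair A R)
    {x x' : E → ℝ} {lam lam' : V → ℝ} (ht : N.IsThinFlow A R x lam)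
    (ht' : N.IsThinFlow A R x' lam') (v : V) : lam v ≤ lam' v := by
  have hcp := ht.isCoupled h
  have hcp' := ht'.isCoupled h
  let c : V → ℝ := fun v => if lam' v < lam v then 1 else 0
  have hsum : ∑ e, (x e - x' e) * (c (N.tgt e) - c (N.src e)) = 0 := by
    simp only [sub_mul, Finset.sum_sub_distrib]
    rw [ht.flow.sum_mul_sub, ht'.flow.sum_mul_sub, sub_self]
  have hmono : ∀ (y y' : E → ℝ) (a a' : V → ℝ), N.IsCoupled A R y a → N.IsCoupled A R y' a' →
      ∀ e, a (N.src e) ≤ a' (N.src e) → a' (N.tgt e) ≤ a (N.tgt e) →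
      (a (N.src e) < a' (N.src e) ∨ a' (N.tgt e) < a (N.tgt e)) → y' e ≤ y e := by
    intro y y' a a' hy hy' e hs ht hor
    by_cases he : e ∈ A
    · rcases (hy'.nonneg e).eq_or_lt with h0 | hpos
      · rw [← h0]; exact hy.nonneg e
      · refine (hy'.le e).trans ((mul_le_mul_of_nonneg_left ht (N.ν_pos e).le).trans_eq ?_)
        by_cases heR : e ∈ R
        · exact (hy.reset e heR).symm
        · have h1 : a' (N.src e) ≤ a' (N.tgt e) := by
            by_contra hlt
            exact hpos.ne' (hy'.zero e he heR (not_le.mp hlt))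
          refine (hy.full e he ?_).symm
          rcases hor with h | h <;> linarith
    · rw [hy'.off e he]; exact hy.nonneg e
  have hterm : ∀ e ∈ Finset.univ, 0 ≤ (x e - x' e) * (c (N.tgt e) - c (N.src e)) := by
    intro e _
    by_cases hs : lam' (N.src e) < lam (N.src e) <;>
      by_cases ht : lam' (N.tgt e) < lam (N.tgt e) <;> simp only [c, hs, ht, if_true, if_false]
    · simp
    · have := hmono x' x lam' lam hcp' hcp e hs.le (not_lt.mp ht) (Or.inl hs)
      linarith
    · have := hmono x x' lam lam' hcp hcp' e (not_lt.mp hs) ht.le (Or.inr ht)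
      linarith
    · simp
  have hzero := (Finset.sum_eq_zero_iff_of_nonneg hterm).mp hsum
  induction v using h.induction with
  | hs => rw [ht.source, ht'.source]
  | hstep w hw =>
    obtain ⟨e, he, rfl, hor⟩ := ht'.exists_tight w hw
    refine ⟨e, he, rfl, fun hle => not_lt.mp fun hlt => ?_⟩
    have h1 := hzero e (Finset.mem_univ e)
    simp only [c, hlt, not_lt.mpr hle, if_true, if_false, sub_zero, mul_one] at h1
    have h2 := mul_lt_mul_of_pos_left hlt (N.ν_pos e)
    rcases hor with heR | hle'
    · rw [hcp.reset e heR, hcp'.reset e heR] at h1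
      linarith
    · rw [hcp.full e he (by linarith)] at h1
      linarith [hcp'.le e]

theorem IsThinFlow.lam_unique [Fintype V] [Fintype E] {A R : Set E}
    (h : N.IsAdmissiblePair A R) {x x' : E → ℝ} {lam lam' : V → ℝ}
    (ht : N.IsThinFlow A R x lam) (ht' : N.IsThinFlow A R x' lam') : lam = lam' :=
  funext fun v => le_antisymm (ht.lam_le h ht' v) (ht'.lam_le h ht v)

/-! ### The vector field -/

/-- Labels do not decrease along active arcs and can stay constant only along arcs of transit time
zero. -/
lemma acyclic_activeArcs (ℓ : V → ℝ) (v : V) :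
    ¬ Relation.TransGen (N.Step (N.activeArcs ℓ)) v v := by
  have key : ∀ a b, Relation.TransGen (N.Step (N.activeArcs ℓ)) a b → ℓ a ≤ ℓ b ∧
      (ℓ b ≤ ℓ a →
        Relation.TransGen (fun a b => ∃ e, N.src e = a ∧ N.tgt e = b ∧ N.τ e = 0) a b) := by
    have hstep : ∀ a b, N.Step (N.activeArcs ℓ) a b → ℓ a ≤ ℓ b ∧
        (ℓ b ≤ ℓ a → ∃ e, N.src e = a ∧ N.tgt e = b ∧ N.τ e = 0) := by
      rintro a b ⟨e, he, rfl, rfl⟩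
      have he : ℓ (N.src e) + N.τ e ≤ ℓ (N.tgt e) := he
      have := N.τ_nonneg e
      exact ⟨by linarith, fun _ => ⟨e, rfl, rfl, by linarith⟩⟩
    intro a b hab
    induction hab with
    | single h => exact ⟨(hstep _ _ h).1, fun h' => .single ((hstep _ _ h).2 h')⟩
    | @tail b c _ hbc ih =>
      obtain ⟨h1, h2⟩ := hstep _ _ hbc
      exact ⟨ih.1.trans h1, fun h' => .tail (ih.2 (h1.trans h')) (h2 (h'.trans ih.1))⟩
  exact fun hv => N.no_zero_cycle v ((key v v hv).2 le_rfl)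

lemma resettingArcs_subset (ℓ : V → ℝ) : N.resettingArcs ℓ ⊆ N.activeArcs ℓ := fun e he => by
  simp only [resettingArcs, activeArcs, Set.mem_ofPred_eq] at he ⊢
  exact he.le

lemma isAdmissiblePair_of_mem {ℓ : V → ℝ} (hℓ : ℓ ∈ N.feasibleLabellings) :
    N.IsAdmissiblePair (N.activeArcs ℓ) (N.resettingArcs ℓ) where
  subset := resettingArcs_subset ℓ
  acyclic := acyclic_activeArcs ℓ
  reach := hℓ.1
  reset_reach := hℓ.2

lemma exists_isThinFlow_X [Fintype V] [Fintype E] {ℓ : V → ℝ} (hℓ : ℓ ∈ N.feasibleLabellings) :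
    ∃ x, N.IsThinFlow (N.activeArcs ℓ) (N.resettingArcs ℓ) x (N.X ℓ) := by
  have h : ∃ lam, N.IsThinFlowLabel ℓ lam := by
    obtain ⟨x, lam, h⟩ := exists_isThinFlow (isAdmissiblePair_of_mem hℓ)
    exact ⟨lam, x, h⟩
  rw [X, dif_pos h]
  exact h.choose_spec

lemma X_eq_of_isThinFlow [Fintype V] [Fintype E] {ℓ : V → ℝ} (hℓ : ℓ ∈ N.feasibleLabellings)
    {x : E → ℝ} {lam : V → ℝ}
    (h : N.IsThinFlow (N.activeArcs ℓ) (N.resettingArcs ℓ) x lam) : N.X ℓ = lam := by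
  obtain ⟨x', h'⟩ := exists_isThinFlow_X hℓ
  exact h'.lam_unique (isAdmissiblePair_of_mem hℓ) h

variable (N) in
lemma X_congr [Fintype E] {ℓ ℓ' : V → ℝ} (hA : N.activeArcs ℓ = N.activeArcs ℓ')
    (hR : N.resettingArcs ℓ = N.resettingArcs ℓ') : N.X ℓ = N.X ℓ' := by
  unfold X IsThinFlowLabel
  rw [hA, hR]

variable (N) in
lemma finite_range_of_arcs [Finite E] {α : Type*} (f : (V → ℝ) → α)
    (hf : ∀ ℓ ℓ', N.activeArcs ℓ = N.activeArcs ℓ' → N.resettingArcs ℓ = N.resettingArcs ℓ' →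
      f ℓ = f ℓ') : (Set.range f).Finite := by
  have h : Function.FactorsThrough f (fun ℓ => (N.activeArcs ℓ, N.resettingArcs ℓ)) :=
    fun ℓ ℓ' h => hf ℓ ℓ' (congrArg Prod.fst h) (congrArg Prod.snd h)
  refine (Set.finite_range fun p : range fun ℓ => (N.activeArcs ℓ, N.resettingArcs ℓ) =>
    f p.2.choose).subset ?_
  rintro _ ⟨ℓ, rfl⟩
  exact ⟨⟨_, ℓ, rfl⟩, h (Set.mem_range_self (f := fun ℓ =>
    (N.activeArcs ℓ, N.resettingArcs ℓ)) ℓ).choose_spec⟩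

variable (N) in
lemma exists_X_bound [Finite V] [Fintype E] : ∃ L : ℝ, 0 ≤ L ∧ ∀ ℓ v, |N.X ℓ v| ≤ L := by
  have := Fintype.ofFinite V
  have hfin := N.finite_range_of_arcs (fun ℓ => ‖N.X ℓ‖) fun ℓ ℓ' hA hR => by
    rw [N.X_congr hA hR]
  obtain ⟨L, hL⟩ := hfin.bddAbove
  exact ⟨L, (norm_nonneg _).trans (hL ⟨0, rfl⟩), fun ℓ v =>
    (norm_le_pi_norm (N.X ℓ) v).trans (hL ⟨ℓ, rfl⟩)⟩

/-! ### Linear extension of trajectories -/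

/-- For short times a nonzero queue value keeps its sign, while a zero one takes the sign of its
slope. -/
lemma exists_arcs_add_smul [Finite E] (ℓ lam : V → ℝ) : ∃ h : ℝ, 0 < h ∧ ∀ θ ∈ Ioc 0 h,
    (∀ e, e ∈ N.activeArcs (ℓ + θ • lam) ↔
      e ∈ N.resettingArcs ℓ ∨ e ∈ N.activeArcs ℓ ∧ lam (N.src e) ≤ lam (N.tgt e)) ∧
    (∀ e, e ∈ N.resettingArcs (ℓ + θ • lam) ↔
      e ∈ N.resettingArcs ℓ ∨ e ∈ N.activeArcs ℓ ∧ lam (N.src e) < lam (N.tgt e)) := by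
  have := Fintype.ofFinite E
  let q : E → ℝ := fun e => ℓ (N.tgt e) - ℓ (N.src e) - N.τ e
  let d : E → ℝ := fun e => lam (N.tgt e) - lam (N.src e)
  have hev : ∀ᶠ h in nhdsWithin (0 : ℝ) (Ioi 0), ∀ e, q e ≠ 0 → h * |d e| < |q e| := by
    refine Filter.eventually_all.mpr fun e => ?_
    by_cases hq : q e = 0
    · exact Filter.Eventually.of_forall fun _ h' => absurd hq h'
    · have : Filter.Tendsto (fun h : ℝ => h * |d e|) (nhdsWithin 0 (Ioi 0)) (nhds (0 * |d e|)) :=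
        ((continuous_id.mul continuous_const).tendsto 0).mono_left nhdsWithin_le_nhds
      filter_upwards [this.eventually_lt_const (by rw [zero_mul]; exact abs_pos.mpr hq)] with h hh _ using hh
  have e0 : ∀ᶠ ε in nhdsWithin (0 : ℝ) (Ioi 0), 0 < ε := self_mem_nhdsWithin
  obtain ⟨h, h0, hh⟩ := (e0.and hev).exists
  refine ⟨h, h0, fun θ hθ => ?_⟩
  have key : ∀ e, (q e < 0 ∧ q e + θ * d e < 0) ∨ (0 < q e ∧ 0 < q e + θ * d e) ∨
      (q e = 0) := by
    intro e
    have h1 : |θ * d e| ≤ h * |d e| := by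
      rw [abs_mul, abs_of_pos hθ.1]
      exact mul_le_mul_of_nonneg_right hθ.2 (abs_nonneg _)
    have h2 := abs_le.mp h1
    rcases lt_trichotomy (q e) 0 with hq | hq | hq
    · have h3 := hh e hq.ne
      rw [abs_of_neg hq] at h3
      exact Or.inl ⟨hq, by linarith⟩
    · exact Or.inr (Or.inr hq)
    · have h3 := hh e hq.ne'
      rw [abs_of_pos hq] at h3
      exact Or.inr (Or.inl ⟨hq, by linarith⟩)
  have hA : ∀ e ℓ', e ∈ N.activeArcs ℓ' ↔ 0 ≤ ℓ' (N.tgt e) - ℓ' (N.src e) - N.τ e := fun e ℓ' => by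
    simp only [activeArcs, Set.mem_ofPred_eq]; constructor <;> intro <;> linarith
  have hR : ∀ e ℓ', e ∈ N.resettingArcs ℓ' ↔ 0 < ℓ' (N.tgt e) - ℓ' (N.src e) - N.τ e :=
    fun e ℓ' => by
      simp only [resettingArcs, Set.mem_ofPred_eq]; constructor <;> intro <;> linarith
  have heq : ∀ e, (ℓ + θ • lam) (N.tgt e) - (ℓ + θ • lam) (N.src e) - N.τ e = q e + θ * d e := by
    intro e
    simp only [Pi.add_apply, Pi.smul_apply, smul_eq_mul, q, d]; ring
  have hqe : ∀ e, ℓ (N.tgt e) - ℓ (N.src e) - N.τ e = q e := fun e => rfl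
  have hθ0 := hθ.1
  constructor <;> intro e
  · rw [hA, hA, hR, heq, hqe]
    rcases key e with ⟨h1, h2⟩ | ⟨h1, h2⟩ | h1
    · simp [h1.not_ge, h2.not_ge, h1.not_gt]
    · simp [h1, h2.le]
    · simp [h1, mul_nonneg_iff_of_pos_left hθ0, d]
  · rw [hR, hA, hR, heq, hqe]
    rcases key e with ⟨h1, h2⟩ | ⟨h1, h2⟩ | h1
    · simp [h1.not_ge, h2.not_gt, h1.not_gt]
    · simp [h1, h2]
    · simp [h1, mul_pos_iff_of_pos_left hθ0, d]

/-- No flow leaves the set of nodes reachable from the head of `e`, while `e` enters it by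
acyclicity; a set with positive net inflow must contain the sink. -/
lemma reachable_sink_of_pos [Fintype V] [Fintype E] {A A' : Set E} {x : E → ℝ}
    (hx : N.IsStaticFlow A x) (hA' : ∀ v, ¬ Relation.TransGen (N.Step A') v v)
    (hpos : ∀ e, 0 < x e → e ∈ A') {e : E} (he : 0 < x e) :
    Relation.ReflTransGen (N.Step A') (N.tgt e) N.t := by
  by_contra hnot
  let c : V → ℝ := fun v => if Relation.ReflTransGen (N.Step A') (N.tgt e) v then 1 else 0
  have hsum := hx.sum_mul_sub c
  have hct : c N.t = 0 := if_neg hnot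
  have hcs : 0 ≤ c N.s := by simp only [c]; split_ifs <;> norm_num
  have hterm : ∀ a ∈ Finset.univ, 0 ≤ x a * (c (N.tgt a) - c (N.src a)) := by
    intro a _
    rcases (hx.nonneg a).eq_or_lt with h0 | h0
    · rw [← h0, zero_mul]
    · refine mul_nonneg h0.le (sub_nonneg.mpr ?_)
      by_cases hs : Relation.ReflTransGen (N.Step A') (N.tgt e) (N.src a)
      · have ht : Relation.ReflTransGen (N.Step A') (N.tgt e) (N.tgt a) :=
          hs.tail ⟨a, hpos a h0, rfl, rfl⟩
        simp [c, hs, ht]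
      · simp only [c, hs, if_false]
        split_ifs <;> norm_num
  have hle := Finset.single_le_sum hterm (Finset.mem_univ e)
  have h1 : c (N.tgt e) = 1 := if_pos .refl
  have h2 : c (N.src e) = 0 := if_neg fun h =>
    hA' (N.tgt e) (Relation.TransGen.tail' h ⟨e, hpos e he, rfl, rfl⟩)
  rw [h1, h2, hsum, hct] at hle
  nlinarith [N.u₀_pos]

/-- The thin flow at `ℓ` remains one after the shift: arcs that become inactive carry no flow, and
arcs that become resetting are already full. Feasibility follows from tight arcs, and from resetting
arcs carrying positive flow. -/
lemma exists_linear_extension [Fintype V] [Fintype E] {ℓ : V → ℝ}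
    (hℓ : ℓ ∈ N.feasibleLabellings) : ∃ h : ℝ, 0 < h ∧ ∀ θ ∈ Icc 0 h,
      ℓ + θ • N.X ℓ ∈ N.feasibleLabellings ∧ N.X (ℓ + θ • N.X ℓ) = N.X ℓ := by
  obtain ⟨h, h0, hh⟩ := exists_arcs_add_smul (N := N) ℓ (N.X ℓ)
  refine ⟨h, h0, fun θ hθ => ?_⟩
  rcases hθ.1.eq_or_lt with hz | hpos
  · rw [← hz]; simpa using hℓ
  obtain ⟨hA, hR⟩ := hh θ ⟨hpos, hθ.2⟩
  have hpair := isAdmissiblePair_of_mem hℓ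
  obtain ⟨x, hx⟩ := exists_isThinFlow_X hℓ
  have hcp := hx.isCoupled hpair
  have hcp' : N.IsCoupled (N.activeArcs (ℓ + θ • N.X ℓ)) (N.resettingArcs (ℓ + θ • N.X ℓ)) x
      (N.X ℓ) := by
    refine ⟨fun e he => ?_, hcp.nonneg, hcp.le, fun e he => ?_, fun e he hlt => ?_,
      fun e he heR hlt => ?_⟩
    · rw [hA] at he
      push Not at he
      by_cases heA : e ∈ N.activeArcs ℓ
      · exact hcp.zero e heA he.1 (he.2 heA)
      · exact hcp.off e heA
    · rcases (hR e).mp he with h1 | h1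
      · exact hcp.reset e h1
      · exact hcp.full e h1.1 h1.2
    · rcases (hA e).mp he with h1 | h1
      · exact hcp.reset e h1
      · exact hcp.full e h1.1 hlt
    · rw [hR] at heR
      push Not at heR
      rcases (hA e).mp he with h1 | h1
      · exact absurd h1 heR.1
      · exact absurd h1.2 (not_le.mpr hlt)
  have htight : ∀ w, w ≠ N.s → ∃ e ∈ N.activeArcs (ℓ + θ • N.X ℓ), N.tgt e = w ∧
      (e ∈ N.resettingArcs (ℓ + θ • N.X ℓ) ∨ N.X ℓ (N.src e) ≤ N.X ℓ w) := by
    intro w hw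
    obtain ⟨e, he, rfl, hor⟩ := hx.exists_tight w hw
    refine ⟨e, (hA e).mpr (hor.imp_right fun h => ⟨he, h⟩), rfl, ?_⟩
    exact hor.imp_left fun h => (hR e).mpr (Or.inl h)
  have hfeas : ℓ + θ • N.X ℓ ∈ N.feasibleLabellings := by
    constructor
    · intro v
      induction v using hpair.induction with
      | hs => exact .refl
      | hstep w hw =>
        obtain ⟨e, he, rfl, hor⟩ := htight w hw
        have heA : e ∈ N.activeArcs ℓ := by
          rcases (hA e).mp he with h1 | h1
          · exact hpair.subset h1
          · exact h1.1
        exact ⟨e, heA, rfl, fun ih => Relation.ReflTransGen.tail ih ⟨e, he, rfl, rfl⟩⟩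
    · intro e he
      refine reachable_sink_of_pos hx.flow (acyclic_activeArcs _) (fun a ha => ?_) ?_
      · by_contra hno
        exact ha.ne' (hcp'.off a hno)
      · rw [hcp'.reset e he]
        exact mul_pos (N.ν_pos e) (hx.lam_pos hpair _)
  exact ⟨hfeas, X_eq_of_isThinFlow hfeas
    (hcp'.isThinFlow hx.source hx.flow.excess_eq htight)⟩

variable (N) in
-- Some active set occurs infinitely often along a convergent sequence, and its arcs stay active in
-- the limit. An arc resetting at the limit is resetting at all late terms.
lemma isClosed_feasibleLabellings [Finite V] [Finite E] : IsClosed N.feasibleLabellings := by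
  refine IsSeqClosed.isClosed fun p q hp hpq => ?_
  have hl : ∀ v, Filter.Tendsto (fun n => p n v) Filter.atTop (nhds (q v)) := fun v =>
    ((continuous_apply v).continuousAt.tendsto).comp hpq
  obtain ⟨A, hA⟩ : ∃ A, ∃ᶠ n in Filter.atTop, N.activeArcs (p n) = A := by
    by_contra hno
    push Not at hno
    have := Filter.eventually_all.mpr hno
    obtain ⟨n, hn⟩ := this.exists
    exact hn _ rfl
  have hsub : A ⊆ N.activeArcs q := by
    intro e he
    by_contra hlt
    have hlt : q (N.tgt e) < q (N.src e) + N.τ e := not_le.mp hlt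
    have hev := (hl (N.tgt e)).eventually_lt ((hl (N.src e)).add_const (N.τ e)) hlt
    obtain ⟨n, hn1, hn2⟩ := (hA.and_eventually hev).exists
    rw [← hn1] at he
    exact absurd he (not_le.mpr hn2)
  have hmono : ∀ a b, Relation.ReflTransGen (N.Step A) a b →
      Relation.ReflTransGen (N.Step (N.activeArcs q)) a b := by
    refine Relation.ReflTransGen.mono ?_
    rintro _ _ ⟨e, he, h⟩
    exact ⟨e, hsub he, h⟩
  constructor
  · intro v
    obtain ⟨n, hn⟩ := hA.exists
    have := (hp n).1 v
    rw [hn] at this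
    exact hmono _ _ this
  · intro e he
    have he : q (N.src e) + N.τ e < q (N.tgt e) := he
    have hev := ((hl (N.src e)).add_const (N.τ e)).eventually_lt (hl (N.tgt e)) he
    obtain ⟨n, hn1, hn2⟩ := (hA.and_eventually hev).exists
    have := (hp n).2 e hn2
    rw [hn1] at this
    exact hmono _ _ this

/-! ### Global existence of Nash trajectories -/

variable (N) in
/-- A Nash trajectory on the time interval `[0, T)` that is linear with slope `X ℓ₀` on `[0, h]`. -/
structure IsPartialTrajectory [Fintype V] [Fintype E] (ℓ₀ : V → ℝ) (h : ℝ) (L : NNReal)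
    (T : EReal) (γ : ℝ → V → ℝ) : Prop where
  lt : (h : EReal) < T
  linear : ∀ θ ∈ Icc 0 h, γ θ = ℓ₀ + θ • N.X ℓ₀
  feasible : ∀ θ : ℝ, 0 ≤ θ → (θ : EReal) < T → γ θ ∈ N.feasibleLabellings
  lipschitz : LipschitzOnWith L γ {θ : ℝ | 0 ≤ θ ∧ (θ : EReal) < T}
  hasDerivAt : ∀ᵐ θ : ℝ, 0 < θ → (θ : EReal) < T → HasDerivAt γ (N.X (γ θ)) θ

/-- The extension relation between partial trajectories. -/
def ExtendedBy (a b : EReal × (ℝ → V → ℝ)) : Prop :=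
  a.1 ≤ b.1 ∧ ∀ θ : ℝ, 0 ≤ θ → (θ : EReal) < a.1 → a.2 θ = b.2 θ

lemma exists_partialTrajectory_of_chain [Fintype V] [Fintype E] {ℓ₀ : V → ℝ} {h : ℝ}
    {L : NNReal} {c : Set {p : EReal × (ℝ → V → ℝ) // N.IsPartialTrajectory ℓ₀ h L p.1 p.2}}
    (hc : IsChain (fun a b => ExtendedBy a.1 b.1) c) (hne : c.Nonempty) :
    ∃ ub : {p : EReal × (ℝ → V → ℝ) // N.IsPartialTrajectory ℓ₀ h L p.1 p.2},
      ∀ a ∈ c, ExtendedBy a.1 ub.1 := by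
  let T : EReal := sSup ((fun a => a.1.1) '' c)
  let γ : ℝ → V → ℝ := fun θ =>
    if H : ∃ a ∈ c, (θ : EReal) < a.1.1 then H.choose.1.2 θ else 0
  have hγ : ∀ a ∈ c, ∀ θ : ℝ, 0 ≤ θ → (θ : EReal) < a.1.1 → a.1.2 θ = γ θ := by
    intro a ha θ hθ hlt
    have H : ∃ a ∈ c, (θ : EReal) < a.1.1 := ⟨a, ha, hlt⟩
    simp only [γ, dif_pos H]
    obtain ⟨hb, hblt⟩ := H.choose_spec
    by_cases hab : a = H.choose
    · rw [← hab]
    · rcases hc ha hb hab with h1 | h1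
      · exact h1.2 θ hθ hlt
      · exact (h1.2 θ hθ hblt).symm
  have hle : ∀ a ∈ c, a.1.1 ≤ T := fun a ha => le_sSup ⟨a, ha, rfl⟩
  have hex : ∀ r : EReal, r < T → ∃ a ∈ c, r < a.1.1 := by
    intro r hr
    obtain ⟨_, ⟨a, ha, rfl⟩, hlt⟩ := lt_sSup_iff.mp hr
    exact ⟨a, ha, hlt⟩
  refine ⟨⟨(T, γ), ?_, ?_, ?_, ?_, ?_⟩, fun a ha => ⟨hle a ha, hγ a ha⟩⟩
  · obtain ⟨a, ha⟩ := hne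
    exact a.2.lt.trans_le (hle a ha)
  · intro θ hθ
    obtain ⟨a, ha⟩ := hne
    show γ θ = _
    rw [← hγ a ha θ hθ.1 (lt_of_le_of_lt (EReal.coe_le_coe_iff.mpr hθ.2) a.2.lt)]
    exact a.2.linear θ hθ
  · intro θ hθ hlt
    obtain ⟨a, ha, hlt'⟩ := hex _ hlt
    show γ θ ∈ _
    rw [← hγ a ha θ hθ hlt']
    exact a.2.feasible θ hθ hlt'
  · refine LipschitzOnWith.of_dist_le_mul ?_
    intro θ₁ h₁ θ₂ h₂
    obtain ⟨a, ha, hlt⟩ := hex (max (θ₁ : EReal) θ₂) (max_lt h₁.2 h₂.2)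
    obtain ⟨hlt₁, hlt₂⟩ := max_lt_iff.mp hlt
    show dist (γ θ₁) (γ θ₂) ≤ _
    rw [← hγ a ha θ₁ h₁.1 hlt₁, ← hγ a ha θ₂ h₂.1 hlt₂]
    exact a.2.lipschitz.dist_le_mul θ₁ ⟨h₁.1, hlt₁⟩ θ₂ ⟨h₂.1, hlt₂⟩
  -- The chain may be uncountable; picking one member beyond each rational below `T` leaves only
  -- countably many null sets to discard.
  · have hall : ∀ᵐ θ : ℝ, ∀ r : ℚ, ∀ hr : ((r : ℝ) : EReal) < T,
        0 < θ → (θ : EReal) < (hex _ hr).choose.1.1 →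
          HasDerivAt (hex _ hr).choose.1.2 (N.X ((hex _ hr).choose.1.2 θ)) θ := by
      rw [ae_all_iff]
      intro r
      by_cases hr : ((r : ℝ) : EReal) < T
      · filter_upwards [(hex _ hr).choose.2.hasDerivAt] with θ hθ _ using hθ
      · exact Filter.Eventually.of_forall fun _ h' => absurd h' hr
    filter_upwards [hall] with θ hθ h0 hlt
    obtain ⟨r, hr1, hr2⟩ := EReal.exists_rat_btwn_of_lt hlt
    obtain ⟨ha, hra⟩ := (hex _ hr2).choose_spec
    have hd := hθ r hr2 h0 (hr1.trans hra)
    have heq : ∀ᶠ ξ in nhds θ, γ ξ = (hex _ hr2).choose.1.2 ξ := by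
      filter_upwards [Ioo_mem_nhds h0 (EReal.coe_lt_coe_iff.mp hr1)] with ξ hξ
      exact (hγ _ ha ξ hξ.1.le ((EReal.coe_lt_coe_iff.mpr hξ.2).trans hra)).symm
    show HasDerivAt γ (N.X (γ θ)) θ
    rw [heq.self_of_nhds]
    exact hd.congr_of_eventuallyEq heq

/-- The Lipschitz bound gives a limit at `T`, which is feasible by closedness, and the trajectory
continues linearly from there. -/
lemma IsPartialTrajectory.exists_extension [Fintype V] [Fintype E] {ℓ₀ : V → ℝ} {h : ℝ}
    (h0 : 0 < h) {L : NNReal} (hL : ∀ ℓ v, |N.X ℓ v| ≤ L) {T : ℝ} {γ : ℝ → V → ℝ}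
    (hγ : N.IsPartialTrajectory ℓ₀ h L (T : EReal) γ) :
    ∃ T' : ℝ, T < T' ∧ ∃ γ', N.IsPartialTrajectory ℓ₀ h L (T' : EReal) γ' ∧
      ExtendedBy ((T : EReal), γ) ((T' : EReal), γ') := by
  obtain ⟨g, hg, hgγ⟩ := hγ.lipschitz.extend_pi
  have hT : h < T := EReal.coe_lt_coe_iff.mp hγ.lt
  have hgγ : ∀ θ, 0 ≤ θ → θ < T → γ θ = g θ := fun θ h1 h2 =>
    hgγ ⟨h1, EReal.coe_lt_coe_iff.mpr h2⟩
  have hfT : g T ∈ N.feasibleLabellings := by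
    refine N.isClosed_feasibleLabellings.mem_of_tendsto (b := nhdsWithin T (Iio T))
      ((hg.continuous.tendsto T).mono_left nhdsWithin_le_nhds) ?_
    filter_upwards [Ioo_mem_nhdsLT (h0.trans hT)] with θ hθ
    rw [← hgγ θ hθ.1.le hθ.2]
    exact hγ.feasible θ hθ.1.le (EReal.coe_lt_coe_iff.mpr hθ.2)
  obtain ⟨k, hk0, hk⟩ := exists_linear_extension hfT
  let γ' : ℝ → V → ℝ := fun θ => if θ ≤ T then g θ else g T + (θ - T) • N.X (g T)
  have h1 : ∀ θ, θ ≤ T → γ' θ = g θ := fun θ hθ => if_pos hθ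
  have h2 : ∀ θ, T ≤ θ → γ' θ = g T + (θ - T) • N.X (g T) := by
    intro θ hθ
    rcases hθ.eq_or_lt with rfl | hlt
    · rw [h1 _ le_rfl]; simp
    · exact if_neg (not_le.mpr hlt)
  have hlip : LipschitzWith L γ' := by
    have hle1 : ∀ a b, a ≤ b → b ≤ T → dist (γ' a) (γ' b) ≤ L * (b - a) := by
      intro a b hab hb
      rw [h1 a (hab.trans hb), h1 b hb]
      refine (hg.dist_le_mul a b).trans_eq ?_
      rw [Real.dist_eq, abs_sub_comm, abs_of_nonneg (sub_nonneg.mpr hab)]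
    have hle2 : ∀ a b, a ≤ b → T ≤ a → dist (γ' a) (γ' b) ≤ L * (b - a) := by
      intro a b hab ha
      rw [h2 a ha, h2 b (ha.trans hab)]
      refine (dist_pi_le_iff (mul_nonneg L.2 (sub_nonneg.mpr hab))).mpr fun v => ?_
      rw [Real.dist_eq]
      have : (g T + (a - T) • N.X (g T)) v - (g T + (b - T) • N.X (g T)) v =
          -((b - a) * N.X (g T) v) := by
        simp only [Pi.add_apply, Pi.smul_apply, smul_eq_mul]; ring
      rw [this, abs_neg, abs_mul, abs_of_nonneg (sub_nonneg.mpr hab), mul_comm]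
      exact mul_le_mul_of_nonneg_right (hL _ _) (sub_nonneg.mpr hab)
    have hle : ∀ a b, a ≤ b → dist (γ' a) (γ' b) ≤ L * (b - a) := by
      intro a b hab
      rcases le_total b T with hb | hb
      · exact hle1 a b hab hb
      · rcases le_total T a with ha | ha
        · exact hle2 a b hab ha
        · have := (dist_triangle (γ' a) (γ' T) (γ' b)).trans
            (add_le_add (hle1 a T ha le_rfl) (hle2 T b hb le_rfl))
          linarith
    refine LipschitzWith.of_dist_le_mul fun a b => ?_
    rw [Real.dist_eq]
    rcases le_total a b with hab | hab
    · rw [abs_sub_comm, abs_of_nonneg (sub_nonneg.mpr hab)]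
      exact hle a b hab
    · rw [dist_comm, abs_of_nonneg (sub_nonneg.mpr hab)]
      exact hle b a hab
  have hTk : T < T + k := by linarith
  refine ⟨T + k, hTk, γ', ⟨?_, ?_, ?_, hlip.lipschitzOnWith, ?_⟩, ?_, ?_⟩
  · exact EReal.coe_lt_coe_iff.mpr (hT.trans hTk)
  · intro θ hθ
    rw [h1 θ (hθ.2.trans hT.le), ← hgγ θ hθ.1 (hθ.2.trans_lt hT)]
    exact hγ.linear θ hθ
  · intro θ hθ hlt
    rcases lt_or_ge θ T with hlt' | hge
    · rw [h1 θ hlt'.le, ← hgγ θ hθ hlt']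
      exact hγ.feasible θ hθ (EReal.coe_lt_coe_iff.mpr hlt')
    · rw [h2 θ hge]
      have := EReal.coe_lt_coe_iff.mp hlt
      exact (hk (θ - T) ⟨by linarith, by linarith⟩).1
  · have hneT : ∀ᵐ θ : ℝ, θ ≠ T := Measure.ae_ne volume T
    filter_upwards [hγ.hasDerivAt, hneT] with θ hθ hne hθ0 hlt
    have hlt := EReal.coe_lt_coe_iff.mp hlt
    rcases lt_or_gt_of_ne hne with hlt' | hgt
    · have hd := hθ hθ0 (EReal.coe_lt_coe_iff.mpr hlt')
      have heq : ∀ᶠ ξ in nhds θ, γ' ξ = γ ξ := by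
        filter_upwards [Ioo_mem_nhds hθ0 hlt'] with ξ hξ
        rw [h1 ξ hξ.2.le, hgγ ξ hξ.1.le hξ.2]
      rw [heq.self_of_nhds]
      exact hd.congr_of_eventuallyEq heq
    · have heq : ∀ᶠ ξ in nhds θ, γ' ξ = g T + (ξ - T) • N.X (g T) := by
        filter_upwards [Ioi_mem_nhds hgt] with ξ hξ
        exact h2 ξ (le_of_lt hξ)
      rw [heq.self_of_nhds, (hk (θ - T) ⟨by linarith, by linarith⟩).2]
      refine HasDerivAt.congr_of_eventuallyEq ?_ heq
      have := (((hasDerivAt_id θ).sub_const T).smul_const (N.X (g T))).const_add (g T)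
      simpa using this
  · exact EReal.coe_le_coe_iff.mpr hTk.le
  · intro θ hθ hlt
    have hlt := EReal.coe_lt_coe_iff.mp hlt
    show γ θ = γ' θ
    rw [h1 θ hlt.le, hgγ θ hθ hlt]

theorem exists_isNashTrajectory [Fintype V] [Fintype E] {ℓ₀ : V → ℝ}
    (hℓ₀ : ℓ₀ ∈ N.feasibleLabellings) : ∃ h : ℝ, 0 < h ∧ ∃ ℓ, N.IsNashTrajectory ℓ₀ ℓ ∧
      ∀ θ ∈ Icc 0 h, ℓ θ = ℓ₀ + θ • N.X ℓ₀ := by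
  obtain ⟨L', hL'0, hL'⟩ := N.exists_X_bound
  lift L' to NNReal using hL'0
  obtain ⟨k, hk0, hk⟩ := exists_linear_extension hℓ₀
  -- Halving makes the closed interval of prescribed linearity lie strictly inside the half-open
  -- domain.
  have hbase : N.IsPartialTrajectory ℓ₀ (k / 2) L' (k : EReal) fun θ => ℓ₀ + θ • N.X ℓ₀ := by
    refine ⟨EReal.coe_lt_coe_iff.mpr (by linarith), fun _ _ => rfl, fun θ hθ hlt =>
      (hk θ ⟨hθ, (EReal.coe_lt_coe_iff.mp hlt).le⟩).1, ?_, Filter.Eventually.of_forall ?_⟩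
    · refine LipschitzOnWith.of_dist_le_mul fun a _ b _ => ?_
      refine (dist_pi_le_iff (mul_nonneg L'.2 dist_nonneg)).mpr fun v => ?_
      rw [Real.dist_eq, Real.dist_eq]
      have : (ℓ₀ + a • N.X ℓ₀) v - (ℓ₀ + b • N.X ℓ₀) v = (a - b) * N.X ℓ₀ v := by
        simp only [Pi.add_apply, Pi.smul_apply, smul_eq_mul]; ring
      rw [this, abs_mul, mul_comm]
      exact mul_le_mul_of_nonneg_right (hL' _ _) (abs_nonneg _)
    · intro θ hθ hlt
      rw [(hk θ ⟨hθ.le, (EReal.coe_lt_coe_iff.mp hlt).le⟩).2]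
      simpa using ((hasDerivAt_id θ).smul_const (N.X ℓ₀)).const_add ℓ₀
  have : Nonempty {p : EReal × (ℝ → V → ℝ) //
    N.IsPartialTrajectory ℓ₀ (k / 2) L' p.1 p.2} :=
    ⟨⟨((k : EReal), fun θ => ℓ₀ + θ • N.X ℓ₀), hbase⟩⟩
  obtain ⟨⟨⟨T, γ⟩, hγ⟩, hmax⟩ := exists_maximal_of_nonempty_chains_bounded
    (r := fun a b : {p : EReal × (ℝ → V → ℝ) //
      N.IsPartialTrajectory ℓ₀ (k / 2) L' p.1 p.2} => ExtendedBy a.1 b.1)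
    (fun c hc hne => exists_partialTrajectory_of_chain hc hne)
    (fun {a b c} hab hbc => ⟨hab.1.trans hbc.1, fun θ hθ hlt =>
      (hab.2 θ hθ hlt).trans (hbc.2 θ hθ (hlt.trans_le hab.1))⟩)
  have hγ : N.IsPartialTrajectory ℓ₀ (k / 2) L' T γ := hγ
  have hT : T = ⊤ := by
    induction T with
    | top => rfl
    | bot => exact absurd hγ.lt not_lt_bot
    | coe T =>
      obtain ⟨T', hTT', γ', hγ', hext⟩ := hγ.exists_extension (half_pos hk0) hL'
      have := (hmax ⟨((T' : EReal), γ'), hγ'⟩ hext).1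
      exact absurd (EReal.coe_le_coe_iff.mp this) (not_le.mpr hTT')
  subst hT
  have hlt : ∀ θ : ℝ, (θ : EReal) < ⊤ := EReal.coe_lt_top
  refine ⟨k / 2, half_pos hk0, γ, ⟨?_, fun θ hθ => hγ.feasible θ hθ (hlt θ), ?_, ?_⟩, hγ.linear⟩
  · simpa using hγ.linear 0 ⟨le_rfl, (half_pos hk0).le⟩
  · intro T hT v
    refine LipschitzOnWith.absolutelyContinuousOnInterval (K := L') ?_
    refine LipschitzOnWith.of_dist_le_mul fun a ha b hb => ?_
    rw [uIcc_of_le hT] at ha hb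
    exact (dist_le_pi_dist _ _ v).trans
      (hγ.lipschitz.dist_le_mul a ⟨ha.1, hlt a⟩ b ⟨hb.1, hlt b⟩)
  · rw [ae_restrict_iff' measurableSet_Ici]
    have hne0 : ∀ᵐ θ : ℝ, θ ≠ 0 := Measure.ae_ne volume 0
    filter_upwards [hγ.hasDerivAt, hne0] with θ hθ hne hθ0 v
    exact hasDerivAt_pi.mp (hθ (lt_of_le_of_ne hθ0 hne.symm) (hlt θ)) v

/-! ### The local potential -/

variable (N) in
/-- The waiting time on the arc `e`, or minus the slack of an inactive arc. -/
def queue (e : E) (ℓ : V → ℝ) : ℝ := ℓ (N.tgt e) - ℓ (N.src e) - N.τ e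

lemma mem_activeArcs_iff {e : E} {ℓ : V → ℝ} : e ∈ N.activeArcs ℓ ↔ 0 ≤ N.queue e ℓ := by
  simp only [activeArcs, queue, Set.mem_ofPred_eq]
  constructor <;> intro <;> linarith

lemma mem_resettingArcs_iff {e : E} {ℓ : V → ℝ} : e ∈ N.resettingArcs ℓ ↔ 0 < N.queue e ℓ := by
  simp only [resettingArcs, queue, Set.mem_ofPred_eq]
  constructor <;> intro <;> linarith

variable (N) in
/-- The growth factor of the steady labels along an arc. -/
def gain [Fintype E] (ℓ₀ : V → ℝ) (e : E) : ℝ := N.X ℓ₀ (N.tgt e) / N.X ℓ₀ (N.src e)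

variable (N) in
/-- The contribution of an arc to the local potential at `ℓ₀`. -/
def arcCost [Fintype E] (ℓ₀ : V → ℝ) (e : E) (ℓ : V → ℝ) : ℝ :=
  if e ∈ N.activeArcs ℓ₀ then
    if e ∈ N.resettingArcs ℓ₀ then
      N.ν e * ((ℓ (N.tgt e) - ℓ₀ (N.tgt e)) - N.gain ℓ₀ e * (ℓ (N.src e) - ℓ₀ (N.src e)))
    else
      N.ν e * (max (N.queue e ℓ) 0 -
        max (N.gain ℓ₀ e - 1) 0 * (ℓ (N.src e) - ℓ₀ (N.src e)))
  else 0

variable (N) in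
/-- The rate of change of `arcCost` along a Nash trajectory. -/
def arcRate [Fintype E] (ℓ₀ : V → ℝ) (e : E) (ℓ : V → ℝ) : ℝ :=
  if e ∈ N.activeArcs ℓ₀ then
    if e ∈ N.resettingArcs ℓ₀ then
      N.ν e * (N.X ℓ (N.tgt e) - N.gain ℓ₀ e * N.X ℓ (N.src e))
    else
      N.ν e * ((if e ∈ N.resettingArcs ℓ then N.X ℓ (N.tgt e) - N.X ℓ (N.src e) else 0) -
        max (N.gain ℓ₀ e - 1) 0 * N.X ℓ (N.src e))
  else 0

variable (N) in
/-- A potential around the labelling `ℓ₀`: it is nonpositive, vanishes at `ℓ₀`, and is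
nondecreasing along Nash trajectories near `ℓ₀`. -/
def potential [Fintype E] (ℓ₀ ℓ : V → ℝ) : ℝ :=
  N.u₀ * ((ℓ N.t - ℓ₀ N.t) / N.X ℓ₀ N.t - (ℓ N.s - ℓ₀ N.s) / N.X ℓ₀ N.s) -
    ∑ e, N.arcCost ℓ₀ e ℓ

variable (N) in
/-- The rate of change of the potential along a Nash trajectory. -/
def rate [Fintype E] (ℓ₀ ℓ : V → ℝ) : ℝ :=
  N.u₀ * (N.X ℓ N.t / N.X ℓ₀ N.t - N.X ℓ N.s / N.X ℓ₀ N.s) - ∑ e, N.arcRate ℓ₀ e ℓ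

variable (N) in
/-- Labellings whose active and resetting arcs are related to those of `ℓ₀` as they are close
to `ℓ₀`. -/
structure IsNear (ℓ₀ ℓ : V → ℝ) : Prop where
  active : N.activeArcs ℓ ⊆ N.activeArcs ℓ₀
  resetting : N.resettingArcs ℓ₀ ⊆ N.resettingArcs ℓ

variable (N) in
/-- Labellings at which the vector field is tangent to all arcs that are active but not
resetting. -/
def IsRegular [Fintype E] (ℓ : V → ℝ) : Prop :=
  ∀ e ∈ N.activeArcs ℓ, e ∉ N.resettingArcs ℓ → N.X ℓ (N.tgt e) = N.X ℓ (N.src e)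

lemma X_pos [Fintype V] [Fintype E] {ℓ : V → ℝ} (hℓ : ℓ ∈ N.feasibleLabellings) (v : V) :
    0 < N.X ℓ v := by
  obtain ⟨x, hx⟩ := exists_isThinFlow_X hℓ
  exact hx.lam_pos (isAdmissiblePair_of_mem hℓ) v

lemma X_source [Fintype V] [Fintype E] {ℓ : V → ℝ} (hℓ : ℓ ∈ N.feasibleLabellings) :
    N.X ℓ N.s = 1 := by
  obtain ⟨x, hx⟩ := exists_isThinFlow_X hℓ
  exact hx.source

lemma queue_eq_zero {ℓ₀ : V → ℝ} {e : E} (he : e ∈ N.activeArcs ℓ₀)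
    (heR : e ∉ N.resettingArcs ℓ₀) : N.queue e ℓ₀ = 0 :=
  le_antisymm (not_lt.mp fun h => heR (mem_resettingArcs_iff.mpr h)) (mem_activeArcs_iff.mp he)

lemma queue_eq_sub {ℓ₀ ℓ : V → ℝ} {e : E} (he : e ∈ N.activeArcs ℓ₀)
    (heR : e ∉ N.resettingArcs ℓ₀) : N.queue e ℓ =
      (ℓ (N.tgt e) - ℓ₀ (N.tgt e)) - (ℓ (N.src e) - ℓ₀ (N.src e)) := by
  have := queue_eq_zero he heR
  unfold queue at this ⊢
  linarith

/-- Flow conservation at `ℓ₀` turns the sink and source terms into a sum over arcs, and `arcCost`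
dominates it arc by arc: with equality on resetting arcs, and elsewhere by distinguishing full, tied
and empty arcs. -/
lemma potential_nonpos [Fintype V] [Fintype E] {ℓ₀ : V → ℝ} (hℓ₀ : ℓ₀ ∈ N.feasibleLabellings)
    (ℓ : V → ℝ) : N.potential ℓ₀ ℓ ≤ 0 := by
  obtain ⟨x, hx⟩ := exists_isThinFlow_X hℓ₀
  have hcp := hx.isCoupled (isAdmissiblePair_of_mem hℓ₀)
  have hsum := hx.flow.sum_mul_sub fun v => (ℓ v - ℓ₀ v) / N.X ℓ₀ v
  unfold potential
  rw [← hsum, sub_nonpos]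
  refine Finset.sum_le_sum fun e _ => ?_
  have hm := X_pos hℓ₀ (N.src e)
  have hm' := X_pos hℓ₀ (N.tgt e)
  have hν := N.ν_pos e
  have hfull : x e = N.ν e * N.X ℓ₀ (N.tgt e) →
      x e * ((ℓ (N.tgt e) - ℓ₀ (N.tgt e)) / N.X ℓ₀ (N.tgt e) -
        (ℓ (N.src e) - ℓ₀ (N.src e)) / N.X ℓ₀ (N.src e)) = N.ν e *
      ((ℓ (N.tgt e) - ℓ₀ (N.tgt e)) - N.gain ℓ₀ e * (ℓ (N.src e) - ℓ₀ (N.src e))) := by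
    intro h
    rw [h, gain]
    field_simp
  unfold arcCost
  split_ifs with hA hR
  · exact (hfull (hcp.reset e hR)).le
  · rw [queue_eq_sub hA hR]
    set a := ℓ (N.tgt e) - ℓ₀ (N.tgt e)
    set b := ℓ (N.src e) - ℓ₀ (N.src e)
    rcases lt_trichotomy (N.X ℓ₀ (N.src e)) (N.X ℓ₀ (N.tgt e)) with hlt | heq | hlt
    · rw [hfull (hcp.full e hA hlt)]
      have hg : 1 < N.gain ℓ₀ e := (one_lt_div hm).mpr hlt
      rw [max_eq_left (by linarith : 0 ≤ N.gain ℓ₀ e - 1)]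
      refine mul_le_mul_of_nonneg_left ?_ hν.le
      linarith [le_max_left (a - b) 0]
    · have hg : N.gain ℓ₀ e = 1 := by rw [gain, heq, div_self hm'.ne']
      rw [hg, sub_self, max_self, zero_mul, sub_zero, heq, ← sub_div, ← mul_div_assoc,
        div_le_iff₀ hm']
      have h1 : x e * (a - b) ≤ x e * max (a - b) 0 :=
        mul_le_mul_of_nonneg_left (le_max_left _ _) (hcp.nonneg e)
      have h2 : x e * max (a - b) 0 ≤ N.ν e * N.X ℓ₀ (N.tgt e) * max (a - b) 0 :=
        mul_le_mul_of_nonneg_right (hcp.le e) (le_max_right _ _)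
      linarith
    · rw [hcp.zero e hA hR hlt, zero_mul]
      have hg : N.gain ℓ₀ e < 1 := (div_lt_one hm).mpr hlt
      rw [max_eq_right (by linarith : N.gain ℓ₀ e - 1 ≤ 0), zero_mul, sub_zero]
      exact mul_nonneg hν.le (le_max_right _ _)
  · rw [hcp.off e hA, zero_mul]

lemma exists_potential_ge [Fintype V] [Fintype E] {ℓ₀ : V → ℝ}
    (hℓ₀ : ℓ₀ ∈ N.feasibleLabellings) :
    ∃ K : ℝ, 0 ≤ K ∧ ∀ ℓ d, (∀ v, |ℓ v - ℓ₀ v| ≤ d) → -N.potential ℓ₀ ℓ ≤ K * d := by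
  have hg : ∀ e, 0 ≤ N.gain ℓ₀ e := fun e =>
    div_nonneg (X_pos hℓ₀ _).le (X_pos hℓ₀ _).le
  have hmt := X_pos hℓ₀ N.t
  have hms := X_pos hℓ₀ N.s
  have hu := N.u₀_pos
  refine ⟨N.u₀ * (1 / N.X ℓ₀ N.t + 1 / N.X ℓ₀ N.s) + ∑ e, N.ν e * (2 + N.gain ℓ₀ e), ?_, ?_⟩
  · exact add_nonneg (by positivity) (Finset.sum_nonneg fun e _ =>
      mul_nonneg (N.ν_pos e).le (by linarith [hg e]))
  · intro ℓ d hd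
    have hd0 : 0 ≤ d := (abs_nonneg _).trans (hd N.s)
    have h1 : -((ℓ N.t - ℓ₀ N.t) / N.X ℓ₀ N.t - (ℓ N.s - ℓ₀ N.s) / N.X ℓ₀ N.s) ≤
        (1 / N.X ℓ₀ N.t + 1 / N.X ℓ₀ N.s) * d := by
      have e1 : -((ℓ N.t - ℓ₀ N.t) / N.X ℓ₀ N.t) ≤ 1 / N.X ℓ₀ N.t * d := by
        rw [← neg_div, one_div_mul_eq_div]
        exact div_le_div_of_nonneg_right (by linarith [(abs_le.mp (hd N.t)).1]) hmt.le
      have e2 : (ℓ N.s - ℓ₀ N.s) / N.X ℓ₀ N.s ≤ 1 / N.X ℓ₀ N.s * d := by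
        rw [one_div_mul_eq_div]
        exact div_le_div_of_nonneg_right (by linarith [(abs_le.mp (hd N.s)).2]) hms.le
      linarith
    have h2 : ∑ e, N.arcCost ℓ₀ e ℓ ≤ ∑ e, N.ν e * (2 + N.gain ℓ₀ e) * d := by
      refine Finset.sum_le_sum fun e _ => ?_
      obtain ⟨a1, a2⟩ := abs_le.mp (hd (N.tgt e))
      obtain ⟨b1, b2⟩ := abs_le.mp (hd (N.src e))
      have hν := N.ν_pos e
      have hge := hg e
      unfold arcCost
      rw [mul_assoc]
      split_ifs with hA hR
      · refine mul_le_mul_of_nonneg_left ?_ hν.le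
        nlinarith
      · refine mul_le_mul_of_nonneg_left ?_ hν.le
        rw [queue_eq_sub hA hR]
        have c1 : max ((ℓ (N.tgt e) - ℓ₀ (N.tgt e)) - (ℓ (N.src e) - ℓ₀ (N.src e))) 0 ≤ 2 * d :=
          max_le (by linarith) (by linarith)
        have c2 : 0 ≤ max (N.gain ℓ₀ e - 1) 0 := le_max_right _ _
        have c3 : max (N.gain ℓ₀ e - 1) 0 ≤ N.gain ℓ₀ e := max_le (by linarith) hge
        have c4 : -(max (N.gain ℓ₀ e - 1) 0 * (ℓ (N.src e) - ℓ₀ (N.src e))) ≤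
            max (N.gain ℓ₀ e - 1) 0 * d := by nlinarith
        have c5 : max (N.gain ℓ₀ e - 1) 0 * d ≤ N.gain ℓ₀ e * d :=
          mul_le_mul_of_nonneg_right c3 hd0
        linarith
      · exact mul_nonneg hν.le (mul_nonneg (by linarith) hd0)
    rw [← Finset.sum_mul] at h2
    unfold potential
    have h3 := mul_le_mul_of_nonneg_left h1 hu.le
    linarith

/-- Every arc rate is bounded by the corresponding entropy term; the consequences of equality
are those needed for trajectories along which the potential does not increase. -/
lemma arcRate_le [Fintype V] [Fintype E] {ℓ₀ ℓ : V → ℝ} (hℓ₀ : ℓ₀ ∈ N.feasibleLabellings)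
    (hℓ : ℓ ∈ N.feasibleLabellings) (hnear : N.IsNear ℓ₀ ℓ) (hreg : N.IsRegular ℓ) {x : E → ℝ}
    (hcp : N.IsCoupled (N.activeArcs ℓ) (N.resettingArcs ℓ) x (N.X ℓ)) {μ : V → ℝ}
    (hμ : ∀ v, μ v = N.X ℓ v / N.X ℓ₀ v) (e : E) :
    N.arcRate ℓ₀ e ℓ ≤ x e * (Real.log (μ (N.tgt e)) - Real.log (μ (N.src e))) ∧
    (N.arcRate ℓ₀ e ℓ = x e * (Real.log (μ (N.tgt e)) - Real.log (μ (N.src e))) →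
      (e ∈ N.activeArcs ℓ → μ (N.src e) ≤ μ (N.tgt e)) ∧
      (e ∈ N.activeArcs ℓ₀ → (e ∈ N.resettingArcs ℓ₀ ∨ N.X ℓ₀ (N.src e) < N.X ℓ₀ (N.tgt e)) →
        μ (N.tgt e) = μ (N.src e)) ∧
      (e ∈ N.resettingArcs ℓ → N.X ℓ₀ (N.src e) = N.X ℓ₀ (N.tgt e) →
        N.X ℓ (N.tgt e) = N.X ℓ (N.src e))) := by
  have hν := N.ν_pos e
  have hm := X_pos hℓ₀ (N.src e)
  have hm' := X_pos hℓ₀ (N.tgt e)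
  have hl := X_pos hℓ (N.src e)
  have hl' := X_pos hℓ (N.tgt e)
  have hμs : 0 < μ (N.src e) := by rw [hμ]; exact div_pos hl hm
  have hμt : 0 < μ (N.tgt e) := by rw [hμ]; exact div_pos hl' hm'
  have hXs : N.X ℓ (N.src e) = μ (N.src e) * N.X ℓ₀ (N.src e) := by
    rw [hμ, div_mul_cancel₀ _ hm.ne']
  have hXt : N.X ℓ (N.tgt e) = μ (N.tgt e) * N.X ℓ₀ (N.tgt e) := by
    rw [hμ, div_mul_cancel₀ _ hm'.ne']
  have hflux : N.ν e * (N.X ℓ (N.tgt e) - N.gain ℓ₀ e * N.X ℓ (N.src e)) =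
      N.ν e * N.X ℓ₀ (N.tgt e) * (μ (N.tgt e) - μ (N.src e)) := by
    rw [hXs, hXt, gain]; field_simp
  have hc : 0 < N.ν e * N.X ℓ₀ (N.tgt e) := mul_pos hν hm'
  have hlog := Real.sub_le_mul_log_sub_log hμt hμs
  set D := Real.log (μ (N.tgt e)) - Real.log (μ (N.src e)) with hD
  have hsat : N.ν e * (N.X ℓ (N.tgt e) - N.gain ℓ₀ e * N.X ℓ (N.src e)) ≤
      N.ν e * N.X ℓ (N.tgt e) * D := by
    rw [hflux, hXt]
    calc _ ≤ N.ν e * N.X ℓ₀ (N.tgt e) * (μ (N.tgt e) * D) :=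
          mul_le_mul_of_nonneg_left hlog hc.le
      _ = _ := by ring
  have hsat' : N.ν e * (N.X ℓ (N.tgt e) - N.gain ℓ₀ e * N.X ℓ (N.src e)) =
      N.ν e * N.X ℓ (N.tgt e) * D → μ (N.tgt e) = μ (N.src e) := by
    intro heq
    by_contra hne
    have h1 := mul_lt_mul_of_pos_left (Real.sub_lt_mul_log_sub_log hμt hμs hne) hc
    rw [hflux, hXt] at heq
    rw [heq] at h1
    exact h1.ne (by rw [hD]; ring)
  unfold arcRate
  split_ifs with hA₀ hR₀ hR
  · rw [hcp.reset e (hnear.resetting hR₀)]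
    refine ⟨hsat, fun heq => ?_⟩
    have := hsat' heq
    refine ⟨fun _ => this.ge, fun _ _ => this, fun _ h => ?_⟩
    rw [hXs, hXt, this, h]
  · rw [hcp.reset e hR]
    rcases le_or_gt (N.X ℓ₀ (N.src e)) (N.X ℓ₀ (N.tgt e)) with hle | hlt
    · have hg : 1 ≤ N.gain ℓ₀ e := (one_le_div hm).mpr hle
      rw [max_eq_left (by linarith : 0 ≤ N.gain ℓ₀ e - 1)]
      have h1 : N.X ℓ (N.tgt e) - N.X ℓ (N.src e) - (N.gain ℓ₀ e - 1) * N.X ℓ (N.src e) =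
        N.X ℓ (N.tgt e) - N.gain ℓ₀ e * N.X ℓ (N.src e) := by ring
      rw [h1]
      refine ⟨hsat, fun heq => ?_⟩
      have := hsat' heq
      refine ⟨fun _ => this.ge, fun _ _ => this, fun _ h => ?_⟩
      rw [hXs, hXt, this, h]
    · have hg : N.gain ℓ₀ e < 1 := (div_lt_one hm).mpr hlt
      rw [max_eq_right (by linarith : N.gain ℓ₀ e - 1 ≤ 0), zero_mul, sub_zero]
      have h1 : N.ν e * (N.X ℓ (N.tgt e) - N.X ℓ (N.src e)) <
          N.ν e * (N.X ℓ (N.tgt e) - N.gain ℓ₀ e * N.X ℓ (N.src e)) :=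
        mul_lt_mul_of_pos_left (by nlinarith) hν
      -- On a resetting arc with gain below one the inequality is strict, so the equality case is
      -- vacuous.
      exact ⟨(h1.trans_le hsat).le, fun heq => absurd heq (h1.trans_le hsat).ne⟩
  · by_cases hA : e ∈ N.activeArcs ℓ
    -- Regularity equates the labels of `X ℓ` at both ends, so the sign of `D` is determined by `X
    -- ℓ₀` alone.
    · have htie := hreg e hA hR
      rcases le_or_gt (N.X ℓ₀ (N.tgt e)) (N.X ℓ₀ (N.src e)) with hle | hlt
      · have hg : N.gain ℓ₀ e ≤ 1 := (div_le_one hm).mpr hle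
        have hμle : μ (N.src e) ≤ μ (N.tgt e) := by
          rw [hμ, hμ, htie]
          exact div_le_div_of_nonneg_left hl.le hm' hle
        rw [max_eq_right (by linarith : N.gain ℓ₀ e - 1 ≤ 0), zero_mul, sub_zero, mul_zero]
        refine ⟨mul_nonneg (hcp.nonneg e) (sub_nonneg.mpr (Real.log_le_log hμs hμle)),
          fun _ => ⟨fun _ => hμle, fun _ h => ?_, fun _ _ => htie⟩⟩
        exact absurd (h.resolve_left hR₀) (not_lt.mpr hle)
      · have hg : 1 < N.gain ℓ₀ e := (one_lt_div hm).mpr hlt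
        have hμlt : μ (N.tgt e) < μ (N.src e) := by
          rw [hμ, hμ, htie]
          exact div_lt_div_of_pos_left hl hm hlt
        rw [max_eq_left (by linarith : 0 ≤ N.gain ℓ₀ e - 1)]
        have hD0 : D ≤ 0 := sub_nonpos.mpr (Real.log_le_log hμt hμlt.le)
        have h1 : N.ν e * N.X ℓ (N.tgt e) * D ≤ x e * D :=
          mul_le_mul_of_nonpos_right (hcp.le e) hD0
        have h2 : N.ν e * (0 - (N.gain ℓ₀ e - 1) * N.X ℓ (N.src e)) =
            N.ν e * (N.X ℓ (N.tgt e) - N.gain ℓ₀ e * N.X ℓ (N.src e)) := by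
          rw [htie]; ring
        rw [h2]
        refine ⟨hsat.trans h1, fun heq => ?_⟩
        exact absurd (hsat' (le_antisymm hsat (heq ▸ h1))) hμlt.ne
    · rw [hcp.off e hA, zero_mul]
      have hM : 0 ≤ max (N.gain ℓ₀ e - 1) 0 := le_max_right _ _
      refine ⟨?_, fun heq => ⟨fun h => absurd h hA, fun _ h => ?_, fun h => absurd h hR⟩⟩
      · have := mul_nonneg hν.le (mul_nonneg hM hl.le)
        linarith
      · have hg : 1 < N.gain ℓ₀ e := (one_lt_div hm).mpr (h.resolve_left hR₀)
        have h1 : 0 < max (N.gain ℓ₀ e - 1) 0 := lt_max_of_lt_left (by linarith)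
        have := mul_pos hν (mul_pos h1 hl)
        linarith
  · have hA : e ∉ N.activeArcs ℓ := fun h => hA₀ (hnear.active h)
    rw [hcp.off e hA, zero_mul]
    exact ⟨le_rfl, fun _ => ⟨fun h => absurd h hA, fun h => absurd h hA₀,
      fun h => absurd (resettingArcs_subset ℓ h) hA⟩⟩

/-- The potential is nondecreasing; where its rate vanishes, the vector field is that of `ℓ₀`
along the arcs that determine the labels. -/
theorem rate_nonneg [Fintype V] [Fintype E] {ℓ₀ ℓ : V → ℝ} (hℓ₀ : ℓ₀ ∈ N.feasibleLabellings)
    (hℓ : ℓ ∈ N.feasibleLabellings) (hnear : N.IsNear ℓ₀ ℓ) (hreg : N.IsRegular ℓ) :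
    0 ≤ N.rate ℓ₀ ℓ ∧ (N.rate ℓ₀ ℓ = 0 →
      (∀ v, N.X ℓ₀ v ≤ N.X ℓ v) ∧
      (∀ e ∈ N.activeArcs ℓ₀, (e ∈ N.resettingArcs ℓ₀ ∨
        N.X ℓ₀ (N.src e) < N.X ℓ₀ (N.tgt e)) → N.X ℓ (N.tgt e) / N.X ℓ₀ (N.tgt e) =
          N.X ℓ (N.src e) / N.X ℓ₀ (N.src e)) ∧
      (∀ e ∈ N.resettingArcs ℓ, N.X ℓ₀ (N.src e) = N.X ℓ₀ (N.tgt e) →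
        N.X ℓ (N.tgt e) = N.X ℓ (N.src e))) := by
  obtain ⟨x, hx⟩ := exists_isThinFlow_X hℓ
  have hcp := hx.isCoupled (isAdmissiblePair_of_mem hℓ)
  set μ : V → ℝ := fun v => N.X ℓ v / N.X ℓ₀ v with hμ
  have harc := arcRate_le hℓ₀ hℓ hnear hreg hcp (μ := μ) fun v => rfl
  have hsum := hx.flow.sum_mul_sub fun v => Real.log (μ v)
  have hμs : μ N.s = 1 := by simp only [hμ, X_source hℓ, X_source hℓ₀, div_one]
  have hμpos : ∀ v, 0 < μ v := fun v => div_pos (X_pos hℓ v) (X_pos hℓ₀ v)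
  have hent : 0 ≤ N.u₀ * (μ N.t - 1 - Real.log (μ N.t)) :=
    mul_nonneg N.u₀_pos.le (by linarith [Real.log_le_sub_one_of_pos (hμpos N.t)])
  -- Adding and subtracting `u₀ * log (μ t)`, written as an arc sum by conservation, exhibits the
  -- rate as a sum of nonnegative terms.
  have hrate : N.rate ℓ₀ ℓ = N.u₀ * (μ N.t - 1 - Real.log (μ N.t)) +
      ∑ e, (x e * (Real.log (μ (N.tgt e)) - Real.log (μ (N.src e))) - N.arcRate ℓ₀ e ℓ) := by
    rw [Finset.sum_sub_distrib, hsum, hμs, Real.log_one, rate]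
    show N.u₀ * (μ N.t - μ N.s) - _ = _
    rw [hμs]; ring
  have hterm : ∀ e ∈ Finset.univ, 0 ≤
      x e * (Real.log (μ (N.tgt e)) - Real.log (μ (N.src e))) - N.arcRate ℓ₀ e ℓ :=
    fun e _ => sub_nonneg.mpr (harc e).1
  have hsum0 := Finset.sum_nonneg hterm
  refine ⟨by rw [hrate]; exact add_nonneg hent hsum0, fun h0 => ?_⟩
  rw [hrate] at h0
  have hz := (Finset.sum_eq_zero_iff_of_nonneg hterm).mp (by linarith)
  have hgood := fun e => (harc e).2 (sub_eq_zero.mp (hz e (Finset.mem_univ e))).symm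
  refine ⟨fun v => ?_, fun e => (hgood e).2.1, fun e => (hgood e).2.2⟩
  have h1 : 1 ≤ μ v := by
    induction hℓ.1 v with
    | refl => exact hμs.ge
    | @tail b c _ hbc ih =>
      obtain ⟨e, he, rfl, rfl⟩ := hbc
      exact ih.trans ((hgood e).1 he)
  exact (one_le_div (X_pos hℓ₀ v)).mp h1

/-! ### Nash trajectories near a feasible labelling -/

variable (N) in
lemma exists_isNear [Finite E] (ℓ₀ : V → ℝ) :
    ∃ r : ℝ, 0 < r ∧ ∀ ℓ, (∀ v, |ℓ v - ℓ₀ v| ≤ r) → N.IsNear ℓ₀ ℓ := by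
  have := Fintype.ofFinite E
  have hev : ∀ᶠ r in nhdsWithin (0 : ℝ) (Ioi 0), ∀ e, N.queue e ℓ₀ ≠ 0 →
      r * 2 < |N.queue e ℓ₀| := by
    refine Filter.eventually_all.mpr fun e => ?_
    by_cases hq : N.queue e ℓ₀ = 0
    · exact Filter.Eventually.of_forall fun _ h' => absurd hq h'
    · have : Filter.Tendsto (fun h : ℝ => h * 2) (nhdsWithin 0 (Ioi 0)) (nhds (0 * 2)) :=
        ((continuous_id.mul continuous_const).tendsto 0).mono_left nhdsWithin_le_nhds
      filter_upwards [this.eventually_lt_const (by rw [zero_mul]; exact abs_pos.mpr hq)]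
        with h hh _ using hh
  have e0 : ∀ᶠ r in nhdsWithin (0 : ℝ) (Ioi 0), 0 < r := self_mem_nhdsWithin
  obtain ⟨r, hr0, hr⟩ := (e0.and hev).exists
  refine ⟨r, hr0, fun ℓ hℓ => ?_⟩
  have hd : ∀ e, |N.queue e ℓ - N.queue e ℓ₀| ≤ r * 2 := by
    intro e
    have h1 := abs_le.mp (hℓ (N.tgt e))
    have h2 := abs_le.mp (hℓ (N.src e))
    rw [abs_le]
    unfold queue
    constructor <;> linarith
  constructor
  · intro e he
    rw [mem_activeArcs_iff] at he ⊢
    by_contra hlt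
    have hlt := not_le.mp hlt
    have h1 := hr e hlt.ne
    rw [abs_of_neg hlt] at h1
    linarith [(abs_le.mp (hd e)).2]
  · intro e he
    rw [mem_resettingArcs_iff] at he ⊢
    have h1 := hr e he.ne'
    rw [abs_of_pos he] at h1
    linarith [(abs_le.mp (hd e)).1]

lemma absolutelyContinuousOnInterval_mul_const (c a b : ℝ) :
    AbsolutelyContinuousOnInterval (fun θ => θ * c) a b :=
  ContDiffOn.absolutelyContinuousOnInterval (by fun_prop)

/-- Active non-resetting arcs have queue zero, and a differentiable zero has derivative zero at
almost every time. -/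
lemma IsNashTrajectory.ae_regular [Finite V] [Fintype E] {ℓ₁ : V → ℝ} {ℓ : ℝ → V → ℝ}
    (h : N.IsNashTrajectory ℓ₁ ℓ) : ∀ᵐ θ : ℝ, 0 ≤ θ →
      (∀ v, HasDerivAt (fun ξ => ℓ ξ v) (N.X (ℓ θ) v) θ) ∧ N.IsRegular (ℓ θ) := by
  have hd := (ae_restrict_iff' measurableSet_Ici).mp h.deriv_eq
  have hq : ∀ᵐ θ : ℝ, ∀ e, N.queue e (ℓ θ) = 0 →
      ∀ d, HasDerivAt (fun ξ => N.queue e (ℓ ξ)) d θ → d = 0 :=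
    ae_all_iff.mpr fun e => ae_hasDerivAt_eq_zero _
  filter_upwards [hd, hq] with θ hd hq h0
  refine ⟨hd h0, fun e he heR => ?_⟩
  have := hq e (queue_eq_zero he heR) _
    (((hd h0 (N.tgt e)).sub (hd h0 (N.src e))).sub_const (N.τ e))
  linarith

lemma IsNashTrajectory.abs_sub_le [Finite V] [Fintype E] {ℓ₁ : V → ℝ} {ℓ : ℝ → V → ℝ}
    (h : N.IsNashTrajectory ℓ₁ ℓ) {L : ℝ} (hL : ∀ ℓ v, |N.X ℓ v| ≤ L) {θ : ℝ} (hθ : 0 ≤ θ)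
    (v : V) : |ℓ θ v - ℓ₁ v| ≤ θ * L := by
  have hlin := absolutelyContinuousOnInterval_mul_const L 0 θ
  have hac := h.absolutelyContinuous θ hθ v
  have h1 := (hlin.sub hac).le_of_ae_hasDerivAt_nonneg hθ (by
    filter_upwards [h.ae_regular] with ξ hξ hmem
    exact ⟨_, sub_nonneg.mpr (abs_le.mp (hL (ℓ ξ) v)).2,
      (hasDerivAt_mul_const L).sub ((hξ hmem.1).1 v)⟩)
  have h2 := (hlin.add hac).le_of_ae_hasDerivAt_nonneg hθ (by
    filter_upwards [h.ae_regular] with ξ hξ hmem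
    exact ⟨_, by linarith [(abs_le.mp (hL (ℓ ξ) v)).1],
      (hasDerivAt_mul_const L).add ((hξ hmem.1).1 v)⟩)
  simp only [Pi.sub_apply, Pi.add_apply, h.initial, zero_mul] at h1 h2
  exact abs_le.mpr ⟨by linarith, by linarith⟩

variable (N) in
/-- A Nash trajectory that stays near the labelling `ℓ₀` on `[0, T]` and starts within distance
`d` of it. -/
structure IsLocalTrajectory [Fintype E] (ℓ₀ : V → ℝ) (T d : ℝ) (ℓ : ℝ → V → ℝ) : Prop where
  nonneg : 0 ≤ T
  nash : N.IsNashTrajectory (ℓ 0) ℓ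
  dist_le : ∀ v, |ℓ 0 v - ℓ₀ v| ≤ d
  near : ∀ θ ∈ Icc 0 T, N.IsNear ℓ₀ (ℓ θ)

lemma IsNashTrajectory.queue_ac [Fintype E] {ℓ₁ : V → ℝ} {ℓ : ℝ → V → ℝ}
    (h : N.IsNashTrajectory ℓ₁ ℓ) {T : ℝ} (hT : 0 ≤ T) (e : E) :
    AbsolutelyContinuousOnInterval (fun θ => N.queue e (ℓ θ)) 0 T :=
  ((h.absolutelyContinuous T hT _).sub (h.absolutelyContinuous T hT _)).sub (.of_const _ _ _)

lemma hasDerivAt_max_queue [Fintype E] {ℓ : ℝ → V → ℝ} {θ : ℝ}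
    (hd : ∀ v, HasDerivAt (fun ξ => ℓ ξ v) (N.X (ℓ θ) v) θ) (hreg : N.IsRegular (ℓ θ)) (e : E) :
    HasDerivAt (fun ξ => max (N.queue e (ℓ ξ)) 0)
      (if e ∈ N.resettingArcs (ℓ θ) then
        N.X (ℓ θ) (N.tgt e) - N.X (ℓ θ) (N.src e) else 0) θ := by
  have hq : HasDerivAt (fun ξ => N.queue e (ℓ ξ))
      (N.X (ℓ θ) (N.tgt e) - N.X (ℓ θ) (N.src e)) θ :=
    ((hd _).sub (hd _)).sub_const _
  simp only [mem_resettingArcs_iff]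
  refine hq.max_zero fun h0 => ?_
  exact sub_eq_zero.mpr (hreg e (mem_activeArcs_iff.mpr h0.ge)
    fun hR => (mem_resettingArcs_iff.mp hR).ne' h0)

lemma IsNashTrajectory.potential_ac [Fintype E] {ℓ₁ : V → ℝ} {ℓ : ℝ → V → ℝ}
    (h : N.IsNashTrajectory ℓ₁ ℓ) (ℓ₀ : V → ℝ) {T : ℝ} (hT : 0 ≤ T) :
    AbsolutelyContinuousOnInterval (fun θ => N.potential ℓ₀ (ℓ θ)) 0 T := by
  have hv : ∀ v, AbsolutelyContinuousOnInterval (fun θ => ℓ θ v - ℓ₀ v) 0 T := fun v =>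
    (h.absolutelyContinuous T hT v).sub (.of_const _ _ _)
  refine AbsolutelyContinuousOnInterval.sub ?_
    (AbsolutelyContinuousOnInterval.finset_sum _ fun e _ => ?_)
  · simp only [div_eq_inv_mul]
    exact (((hv _).const_mul _).sub ((hv _).const_mul _)).const_mul _
  · unfold arcCost
    split_ifs
    · exact ((hv _).sub ((hv _).const_mul _)).const_mul _
    · exact ((h.queue_ac hT e).max_zero.sub ((hv _).const_mul _)).const_mul _
    · exact .of_const _ _ _

lemma hasDerivAt_potential [Fintype E] (ℓ₀ : V → ℝ) {ℓ : ℝ → V → ℝ} {θ : ℝ}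
    (hd : ∀ v, HasDerivAt (fun ξ => ℓ ξ v) (N.X (ℓ θ) v) θ) (hreg : N.IsRegular (ℓ θ)) :
    HasDerivAt (fun ξ => N.potential ℓ₀ (ℓ ξ)) (N.rate ℓ₀ (ℓ θ)) θ := by
  have hv : ∀ v, HasDerivAt (fun ξ => ℓ ξ v - ℓ₀ v) (N.X (ℓ θ) v) θ := fun v =>
    (hd v).sub_const _
  refine HasDerivAt.sub ((((hv _).div_const _).sub ((hv _).div_const _)).const_mul _)
    (HasDerivAt.fun_sum fun e _ => ?_)
  unfold arcCost arcRate
  split_ifs with hA hR hR'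
  · exact ((hv _).sub ((hv _).const_mul _)).const_mul _
  · have := hasDerivAt_max_queue hd hreg e
    rw [if_pos hR'] at this
    exact (this.sub ((hv _).const_mul _)).const_mul _
  · have := hasDerivAt_max_queue hd hreg e
    rw [if_neg hR'] at this
    exact (this.sub ((hv _).const_mul _)).const_mul _
  · exact hasDerivAt_const _ _

/-! ### Comparison with the potential and linear stability estimates -/

variable (N) in
-- The quotient of `F` by `G` takes finitely many values; where `G` vanishes the sign condition on
-- `F` replaces it.
lemma exists_le_mul_of_arcs [Finite E] (F G : (V → ℝ) → ℝ)
    (hF : ∀ ℓ ℓ', N.activeArcs ℓ = N.activeArcs ℓ' → N.resettingArcs ℓ = N.resettingArcs ℓ' →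
      F ℓ = F ℓ')
    (hG : ∀ ℓ ℓ', N.activeArcs ℓ = N.activeArcs ℓ' → N.resettingArcs ℓ = N.resettingArcs ℓ' →
      G ℓ = G ℓ') :
    ∃ C : ℝ, 0 ≤ C ∧ ∀ ℓ, 0 ≤ G ℓ → (G ℓ = 0 → F ℓ ≤ 0) → F ℓ ≤ C * G ℓ := by
  obtain ⟨C, hC⟩ := (N.finite_range_of_arcs (fun ℓ => F ℓ / G ℓ) fun ℓ ℓ' hA hR => by
    rw [hF ℓ ℓ' hA hR, hG ℓ ℓ' hA hR]).bddAbove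
  refine ⟨max C 0, le_max_right _ _, fun ℓ h0 hz => ?_⟩
  rcases h0.eq_or_lt with h | h
  · rw [← h, mul_zero]; exact hz h.symm
  · rw [← div_le_iff₀ h]
    exact (hC ⟨ℓ, rfl⟩).trans (le_max_left _ _)

variable (N) in
lemma rate_congr [Fintype E] (ℓ₀ : V → ℝ) {ℓ ℓ' : V → ℝ}
    (hA : N.activeArcs ℓ = N.activeArcs ℓ') (hR : N.resettingArcs ℓ = N.resettingArcs ℓ') :
    N.rate ℓ₀ ℓ = N.rate ℓ₀ ℓ' := by
  unfold rate arcRate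
  rw [N.X_congr hA hR, hR]

/-- A quantity whose derivative along a trajectory is nonpositive whenever the potential is
stationary grows at most linearly with the initial distance to `ℓ₀`. -/
lemma exists_comparison [Fintype V] [Fintype E] {ℓ₀ : V → ℝ} (hℓ₀ : ℓ₀ ∈ N.feasibleLabellings)
    (F : (V → ℝ) → ℝ)
    (hF : ∀ ℓ ℓ', N.activeArcs ℓ = N.activeArcs ℓ' → N.resettingArcs ℓ = N.resettingArcs ℓ' →
      F ℓ = F ℓ')
    (hF0 : ∀ ℓ ∈ N.feasibleLabellings, N.IsNear ℓ₀ ℓ → N.IsRegular ℓ → N.rate ℓ₀ ℓ = 0 →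
      F ℓ ≤ 0) :
    ∃ K : ℝ, 0 ≤ K ∧ ∀ T d ℓ, N.IsLocalTrajectory ℓ₀ T d ℓ → ∀ f : ℝ → ℝ,
      AbsolutelyContinuousOnInterval f 0 T →
      (∀ θ ∈ Icc 0 T, (∀ v, HasDerivAt (fun ξ => ℓ ξ v) (N.X (ℓ θ) v) θ) →
        N.IsRegular (ℓ θ) → HasDerivAt f (F (ℓ θ)) θ) → f T ≤ f 0 + K * d := by
  obtain ⟨C, hC0, hC⟩ := N.exists_le_mul_of_arcs F (N.rate ℓ₀) hF
    fun ℓ ℓ' hA hR => N.rate_congr ℓ₀ hA hR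
  obtain ⟨K, hK0, hK⟩ := exists_potential_ge hℓ₀
  refine ⟨C * K, mul_nonneg hC0 hK0, fun T d ℓ hℓ f hf hfd => ?_⟩
  have hpot := (hℓ.nash.potential_ac ℓ₀ hℓ.nonneg).const_mul C
  -- `C` times the potential minus `f` is nondecreasing; the final potential is nonpositive and the
  -- initial one is at least `-K * d`.
  have hle := (hpot.sub hf).le_of_ae_hasDerivAt_nonneg hℓ.nonneg (by
    filter_upwards [hℓ.nash.ae_regular] with θ hθ hmem
    obtain ⟨hd, hreg⟩ := hθ hmem.1
    have hfeas := hℓ.nash.feasible θ hmem.1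
    have hnear := hℓ.near θ hmem
    refine ⟨_, sub_nonneg.mpr (hC (ℓ θ) (rate_nonneg hℓ₀ hfeas hnear hreg).1
      (hF0 _ hfeas hnear hreg)), ?_⟩
    exact ((hasDerivAt_potential ℓ₀ hd hreg).const_mul C).sub (hfd θ hmem hd hreg))
  simp only [Pi.sub_apply] at hle
  have h1 := mul_nonpos_of_nonneg_of_nonpos hC0 (potential_nonpos hℓ₀ (ℓ T))
  have h2 := mul_le_mul_of_nonneg_left (hK (ℓ 0) d hℓ.dist_le) hC0
  linarith

/-- Local trajectories do not advance much faster than linearly with slope `X ℓ₀`. -/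
lemma exists_upper_bound [Fintype V] [Fintype E] {ℓ₀ : V → ℝ}
    (hℓ₀ : ℓ₀ ∈ N.feasibleLabellings) (v : V) :
    ∃ K : ℝ, 0 ≤ K ∧ ∀ T d ℓ, N.IsLocalTrajectory ℓ₀ T d ℓ →
      ℓ T v - ℓ₀ v - T * N.X ℓ₀ v ≤ K * d := by
  have hpair := isAdmissiblePair_of_mem hℓ₀
  obtain ⟨x, hx⟩ := exists_isThinFlow_X hℓ₀
  have hzac : ∀ {T d ℓ}, N.IsLocalTrajectory ℓ₀ T d ℓ → ∀ v,
      AbsolutelyContinuousOnInterval (fun θ => ℓ θ v - ℓ₀ v - θ * N.X ℓ₀ v) 0 T := fun hℓ v =>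
    ((hℓ.nash.absolutelyContinuous _ hℓ.nonneg v).sub (.of_const _ _ _)).sub
      (absolutelyContinuousOnInterval_mul_const _ _ _)
  have hzd : ∀ {ℓ : ℝ → V → ℝ} {θ : ℝ}, (∀ v, HasDerivAt (fun ξ => ℓ ξ v) (N.X (ℓ θ) v) θ) →
      ∀ v, HasDerivAt (fun θ => ℓ θ v - ℓ₀ v - θ * N.X ℓ₀ v) (N.X (ℓ θ) v - N.X ℓ₀ v) θ :=
    fun hd v => ((hd v).sub_const _).sub (hasDerivAt_mul_const _)
  induction v using hpair.induction with
  | hs =>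
    obtain ⟨K, hK0, hK⟩ := exists_comparison hℓ₀ (fun ℓ => N.X ℓ N.s - N.X ℓ₀ N.s)
      (fun ℓ ℓ' hA hR => by rw [N.X_congr hA hR])
      (fun ℓ hℓ _ _ _ => by rw [X_source hℓ, X_source hℓ₀, sub_self])
    refine ⟨1 + K, by linarith, fun T d ℓ hℓ => ?_⟩
    have h1 := hK T d ℓ hℓ _ (hzac hℓ N.s) fun θ _ hd _ => hzd hd N.s
    have h2 := (abs_le.mp (hℓ.dist_le N.s)).2
    simp only [zero_mul, sub_zero] at h1
    linarith
  | hstep w hw =>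
    obtain ⟨e, he, rfl, hor⟩ := hx.exists_tight w hw
    refine ⟨e, he, rfl, ?_⟩
    rintro ⟨K₁, hK₁0, hK₁⟩
    have hm := X_pos hℓ₀ (N.src e)
    have hm' := X_pos hℓ₀ (N.tgt e)
    -- In this case a stationary potential forces equal ratios `X ℓ / X ℓ₀` at both ends, so the
    -- difference of the normalized deviations is controlled.
    by_cases hcase : e ∈ N.resettingArcs ℓ₀ ∨ N.X ℓ₀ (N.src e) < N.X ℓ₀ (N.tgt e)
    · obtain ⟨K, hK0, hK⟩ := exists_comparison hℓ₀
        (fun ℓ => (N.X ℓ (N.tgt e) - N.X ℓ₀ (N.tgt e)) / N.X ℓ₀ (N.tgt e) -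
          (N.X ℓ (N.src e) - N.X ℓ₀ (N.src e)) / N.X ℓ₀ (N.src e))
        (fun ℓ ℓ' hA hR => by rw [N.X_congr hA hR])
        (fun ℓ hℓ hnear hreg hz => by
          have := ((rate_nonneg hℓ₀ hℓ hnear hreg).2 hz).2.1 e he hcase
          rw [sub_div, sub_div, this, div_self hm.ne', div_self hm'.ne', sub_self])
      refine ⟨N.X ℓ₀ (N.tgt e) * ((K₁ + 1) / N.X ℓ₀ (N.src e) + K) + 1,
        by positivity, fun T d ℓ hℓ => ?_⟩
      have h1 := hK T d ℓ hℓ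
        (fun θ => (ℓ θ (N.tgt e) - ℓ₀ (N.tgt e) - θ * N.X ℓ₀ (N.tgt e)) / N.X ℓ₀ (N.tgt e) -
          (ℓ θ (N.src e) - ℓ₀ (N.src e) - θ * N.X ℓ₀ (N.src e)) / N.X ℓ₀ (N.src e)) (by
          simp only [div_eq_inv_mul]
          exact ((hzac hℓ _).const_mul _).sub ((hzac hℓ _).const_mul _))
        (fun θ _ hd _ => ((hzd hd _).div_const _).sub ((hzd hd _).div_const _))
      have h2 := abs_le.mp (hℓ.dist_le (N.tgt e))
      have h3 := abs_le.mp (hℓ.dist_le (N.src e))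
      have h4 := hK₁ T d ℓ hℓ
      simp only [zero_mul, sub_zero] at h1
      have h5 : (ℓ 0 (N.tgt e) - ℓ₀ (N.tgt e)) / N.X ℓ₀ (N.tgt e) ≤ d / N.X ℓ₀ (N.tgt e) :=
        div_le_div_of_nonneg_right h2.2 hm'.le
      have h6 : -d / N.X ℓ₀ (N.src e) ≤ (ℓ 0 (N.src e) - ℓ₀ (N.src e)) / N.X ℓ₀ (N.src e) :=
        div_le_div_of_nonneg_right h3.1 hm.le
      have h7 : (ℓ T (N.src e) - ℓ₀ (N.src e) - T * N.X ℓ₀ (N.src e)) / N.X ℓ₀ (N.src e) ≤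
          K₁ * d / N.X ℓ₀ (N.src e) := div_le_div_of_nonneg_right h4 hm.le
      have h8 : (ℓ T (N.tgt e) - ℓ₀ (N.tgt e) - T * N.X ℓ₀ (N.tgt e)) / N.X ℓ₀ (N.tgt e) ≤
          d / N.X ℓ₀ (N.tgt e) + d / N.X ℓ₀ (N.src e) + K₁ * d / N.X ℓ₀ (N.src e) + K * d := by
        rw [neg_div] at h6
        linarith
      rw [div_le_iff₀ hm'] at h8
      refine h8.trans_eq ?_
      field_simp
      ring
    · push Not at hcase
      -- In the remaining tied case the positive part of the queue is controlled instead; it bounds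
      -- how far the head can run ahead of the tail.
      have heq : N.X ℓ₀ (N.src e) = N.X ℓ₀ (N.tgt e) :=
        le_antisymm (hor.resolve_left hcase.1) hcase.2
      obtain ⟨K, hK0, hK⟩ := exists_comparison hℓ₀
        (fun ℓ => if e ∈ N.resettingArcs ℓ then N.X ℓ (N.tgt e) - N.X ℓ (N.src e) else 0)
        (fun ℓ ℓ' hA hR => by rw [N.X_congr hA hR, hR])
        (fun ℓ hℓ hnear hreg hz => by
          split_ifs with hR
          · rw [((rate_nonneg hℓ₀ hℓ hnear hreg).2 hz).2.2 e hR heq, sub_self]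
          · exact le_rfl)
      refine ⟨K₁ + 2 + K, by linarith, fun T d ℓ hℓ => ?_⟩
      have h1 := hK T d ℓ hℓ _ (hℓ.nash.queue_ac hℓ.nonneg e).max_zero
        fun θ _ hd hreg => hasDerivAt_max_queue hd hreg e
      have h2 := abs_le.mp (hℓ.dist_le (N.tgt e))
      have h3 := abs_le.mp (hℓ.dist_le (N.src e))
      have h4 := hK₁ T d ℓ hℓ
      have h5 := le_max_left (N.queue e (ℓ T)) 0
      have h6 : max (N.queue e (ℓ 0)) 0 ≤ 2 * d := by
        rw [queue_eq_sub he hcase.1]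
        have := (abs_nonneg _).trans (hℓ.dist_le (N.src e))
        exact max_le (by linarith) (by linarith)
      have h7 := queue_eq_sub (ℓ := ℓ T) he hcase.1
      rw [← heq]
      linarith

/-- Local trajectories do not advance much slower than linearly with slope `X ℓ₀`. -/
lemma exists_lower_bound [Fintype V] [Fintype E] {ℓ₀ : V → ℝ}
    (hℓ₀ : ℓ₀ ∈ N.feasibleLabellings) (v : V) :
    ∃ K : ℝ, 0 ≤ K ∧ ∀ T d ℓ, N.IsLocalTrajectory ℓ₀ T d ℓ →
      -(ℓ T v - ℓ₀ v - T * N.X ℓ₀ v) ≤ K * d := by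
  obtain ⟨K, hK0, hK⟩ := exists_comparison hℓ₀ (fun ℓ => N.X ℓ₀ v - N.X ℓ v)
    (fun ℓ ℓ' hA hR => by rw [N.X_congr hA hR])
    (fun ℓ hℓ hnear hreg hz =>
      sub_nonpos.mpr (((rate_nonneg hℓ₀ hℓ hnear hreg).2 hz).1 v))
  refine ⟨1 + K, by linarith, fun T d ℓ hℓ => ?_⟩
  have h1 := hK T d ℓ hℓ (fun θ => θ * N.X ℓ₀ v - ℓ θ v)
    ((absolutelyContinuousOnInterval_mul_const _ _ _).sub
      (hℓ.nash.absolutelyContinuous _ hℓ.nonneg v))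
    fun θ _ hd _ => (hasDerivAt_mul_const _).sub (hd v)
  have h2 := (abs_le.mp (hℓ.dist_le v)).1
  linarith

lemma exists_l1dist_bound [Fintype V] [Fintype E] {ℓ₀ : V → ℝ}
    (hℓ₀ : ℓ₀ ∈ N.feasibleLabellings) :
    ∃ K : ℝ, 0 ≤ K ∧ ∀ T d ℓ, N.IsLocalTrajectory ℓ₀ T d ℓ →
      l1dist (ℓ₀ + T • N.X ℓ₀) (ℓ T) ≤ K * d := by
  choose K₁ hK₁0 hK₁ using fun v => exists_upper_bound (N := N) hℓ₀ v
  choose K₂ hK₂0 hK₂ using fun v => exists_lower_bound (N := N) hℓ₀ v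
  refine ⟨∑ v, (K₁ v + K₂ v), Finset.sum_nonneg fun v _ => add_nonneg (hK₁0 v) (hK₂0 v),
    fun T d ℓ hℓ => ?_⟩
  have hd : 0 ≤ d := (abs_nonneg _).trans (hℓ.dist_le N.s)
  rw [l1dist, Finset.sum_mul]
  refine Finset.sum_le_sum fun v _ => ?_
  have h1 := hK₁ v T d ℓ hℓ
  have h2 := hK₂ v T d ℓ hℓ
  have h3 := mul_nonneg (hK₁0 v) hd
  have h4 := mul_nonneg (hK₂0 v) hd
  simp only [Pi.add_apply, Pi.smul_apply, smul_eq_mul]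
  rw [abs_le]
  constructor <;> linarith

end FlowNetwork

end

theorem mainTheorem5 {V E : Type*} [Fintype V] [Fintype E] (N : FlowNetwork V E)
    (ℓ₀ : V → ℝ) (hℓ₀ : ℓ₀ ∈ N.feasibleLabellings) :
    ∃ θhat : ℝ, 0 < θhat ∧
      ∃ ℓs : ℝ → V → ℝ, N.IsNashTrajectory ℓ₀ ℓs ∧
        (∀ θ ∈ Icc 0 θhat, ℓs θ = ℓ₀ + θ • N.X ℓ₀) ∧
        ∀ ε : ℝ, 0 < ε → ∃ δ : ℝ, 0 < δ ∧
          ∀ ℓ₁ ∈ N.feasibleLabellings, l1dist ℓ₁ ℓ₀ ≤ δ →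
            ∀ ℓt : ℝ → V → ℝ, N.IsNashTrajectory ℓ₁ ℓt →
              ∀ θ ∈ Icc 0 θhat, l1dist (ℓs θ) (ℓt θ) ≤ ε := by
  obtain ⟨h, h0, ℓs, hs, hlin⟩ := FlowNetwork.exists_isNashTrajectory hℓ₀
  obtain ⟨r, hr0, hr⟩ := N.exists_isNear ℓ₀
  obtain ⟨L, hL0, hL⟩ := N.exists_X_bound
  obtain ⟨K, hK0, hK⟩ := FlowNetwork.exists_l1dist_bound hℓ₀
  -- Up to this time, which is independent of `ε`, a trajectory drifts at most `r / 2`; starting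
  -- within `r / 2` of `ℓ₀`, it stays in the neighbourhood where `IsNear` holds.
  have hT0 : 0 < min h (r / 2 / (L + 1)) := by positivity
  refine ⟨min h (r / 2 / (L + 1)), hT0, ℓs, hs,
    fun θ hθ => hlin θ ⟨hθ.1, hθ.2.trans (min_le_left _ _)⟩, fun ε hε => ?_⟩
  refine ⟨min (r / 2) (ε / (K + 1)), by positivity, fun ℓ₁ _ hδ ℓt hℓt θ hθ => ?_⟩
  have hdist : ∀ v, |ℓ₁ v - ℓ₀ v| ≤ l1dist ℓ₁ ℓ₀ := fun v =>
    Finset.single_le_sum (f := fun v => |ℓ₁ v - ℓ₀ v|) (fun v _ => abs_nonneg _)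
      (Finset.mem_univ v)
  have hd1 := hδ.trans (min_le_left _ _)
  have hd2 := hδ.trans (min_le_right _ _)
  have hlocal : N.IsLocalTrajectory ℓ₀ θ (l1dist ℓ₁ ℓ₀) ℓt := by
    refine ⟨hθ.1, hℓt.initial ▸ hℓt, fun v => hℓt.initial ▸ hdist v, fun ξ hξ => hr _ fun v => ?_⟩
    have h1 := hℓt.abs_sub_le hL hξ.1 v
    have h2 : ξ * L ≤ r / 2 := by
      have h3 : ξ ≤ r / 2 / (L + 1) := hξ.2.trans (hθ.2.trans (min_le_right _ _))
      rw [le_div_iff₀ (by linarith)] at h3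
      nlinarith [hξ.1]
    have h4 := abs_sub_le (ℓt ξ v) (ℓ₁ v) (ℓ₀ v)
    linarith [hdist v]
  rw [hlin θ ⟨hθ.1, hθ.2.trans (min_le_left _ _)⟩]
  refine (hK θ _ ℓt hlocal).trans ?_
  rw [le_div_iff₀ (by linarith)] at hd2
  have h5 : 0 ≤ l1dist ℓ₁ ℓ₀ := (abs_nonneg _).trans (hdist N.s)
  linarith
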